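/- Let $(\rho_n)_{n\ge 0}$ be a monotone (hence decreasing) sequence of positive numbers with $\rho_n\to 0$ and $\sum_n\rho_n=\infty$. On $H=\ell^2(\mathbb Z)\oplus\ell^2(\mathbb Z)$ (complex scalars) let $$T=\begin{pmatrix}U&R\\0&U\end{pmatrix},\qquad Ue_n=e_{n+1},\quad Re_n=\rho_{|n|}e_n\quad(n\in\mathbb Z),$$ where $(e_n)_{n\in\mathbb Z}$ is the standard basis of $\ell^2(\mathbb Z)$. Notation. Let $\mathbb D=\{|z|<1\}$, $\mathbb T=\{|z|=1\}$, and let $H^2$ be the Hardy space of $\mathbb D$. For a bounded operator $A$ whose spectrum has no accumulation points off $\mathbb T$, let $\widetilde{H^w_+}(A)$ be the set of vectors $u$ such that $(A-z)^{-1}u$ is analytic in $\mathbb D$ and $\langle(A-z)^{-1}u,v\rangle|_{\mathbb D}\in H^2$ for all $v$; let $\widetilde{H^w_-}(A)$ be the set of vectors $u$ such that $(A-z)^{-1}u$ is analytic in $\mathbb C\setminus\overline{\mathbb D}$ and $\langle(I-zA)^{-1}u,v\rangle|_{\mathbb D}\in H^2$ for all $v$. Let $H^w_{ac}(A)$ be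 the closure of $\widetilde{H^w_+}(A)\cap\widetilde{H^w_-}(A)$, and $CN(A)$ the closure of the linear span of $\widetilde{H^w_+}(A)\cup\widetilde{H^w_-}(A)$. If $\sigma(A)\subset\mathbb T$, let $H_s(A)$ be the closure of the set of vectors $u$ such that for every $v$, at almost every point of $\mathbb T$, the nontangential limits of $\langle(A-w)^{-1}u,v\rangle$ from inside and from outside $\mathbb D$ exist and coincide. The singular numbers $\mu_1(S)\ge\mu_2(S)\ge\dots$ of a compact operator $S$ are the eigenvalues of $(S^*S)^{1/2}$, repeated according to multiplicity. Then $\sigma(T)=\mathbb T$, and: (i) $CN(T)\ne H$; more precisely, $CN(T)=\ell^2(\mathbb Z)\oplus\{0\}$; (ii) $H_s(T^*)=\{0\}$; (iii) $T=T_0+S$, where $T_0$ is unitary and $S$ is a compact operator whose singular numbers satisfy $\mu_n(S)\le\rho_{[n/2]}$ for all $n\ge 1$. In particular, the duality relation $(H^w_{ac}(T))^\perp=H_s(T^*)$ fails for $T$. -/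

import Mathlib

open Filter Topology Set

namespace SpectralDuality

/-! ### The Hardy space of the disk and nontangential limits -/

/-- The Hardy class `H²` of the unit disk: `f` is analytic in the disk, and its quadratic means
over the circles of radius `r < 1` are bounded. -/
def MemH2 (f : ℂ → ℂ) : Prop :=
  DifferentiableOn ℂ f (Metric.ball 0 1) ∧
    ∃ C : ℝ, ∀ r : ℝ, 0 ≤ r → r < 1 → Real.circleAverage (fun z => ‖f z‖ ^ 2) 0 r ≤ C

theorem MemH2.circleIntegrable {f : ℂ → ℂ} (hf : DifferentiableOn ℂ f (Metric.ball 0 1)) {r : ℝ}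
    (h0 : 0 ≤ r) (h1 : r < 1) : CircleIntegrable (fun z => ‖f z‖ ^ 2) 0 r := by
  refine ContinuousOn.circleIntegrable h0 ?_
  refine ((hf.continuousOn.mono ?_).norm).pow 2
  intro z hz
  rw [mem_sphere_zero_iff_norm] at hz
  rw [mem_ball_zero_iff, hz]
  exact h1

theorem MemH2.zero : MemH2 (fun _ => 0) :=
  ⟨differentiableOn_const _, 0, fun r _ _ => by simp [Real.circleAverage_const]⟩

theorem MemH2.add {f g : ℂ → ℂ} (hf : MemH2 f) (hg : MemH2 g) : MemH2 (fun z => f z + g z) := by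
  obtain ⟨hf, C, hC⟩ := hf
  obtain ⟨hg, D, hD⟩ := hg
  refine ⟨hf.add hg, 2 * C + 2 * D, fun r h0 h1 => ?_⟩
  have If := MemH2.circleIntegrable hf h0 h1
  have Ig := MemH2.circleIntegrable hg h0 h1
  have key : Real.circleAverage (fun z => ‖f z + g z‖ ^ 2) 0 r ≤
      Real.circleAverage ((2 : ℝ) • (fun z => ‖f z‖ ^ 2) + (2 : ℝ) • (fun z => ‖g z‖ ^ 2)) 0 r := by
    refine Real.circleAverage_mono (MemH2.circleIntegrable (hf.add hg) h0 h1)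
      ((If.const_smul).add (Ig.const_smul)) ?_
    intro z _
    have h := norm_add_le (f z) (g z)
    have h' := norm_nonneg (f z + g z)
    simp only [Pi.add_apply, Pi.smul_apply, smul_eq_mul]
    nlinarith [sq_nonneg (‖f z‖ - ‖g z‖)]
  rw [Real.circleAverage_add (If.const_smul) (Ig.const_smul), Real.circleAverage_smul,
    Real.circleAverage_smul] at key
  have h1' := hC r h0 h1
  have h2' := hD r h0 h1
  simp only [smul_eq_mul] at key
  linarith

theorem MemH2.const_mul {f : ℂ → ℂ} (c : ℂ) (hf : MemH2 f) : MemH2 (fun z => c * f z) := by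
  obtain ⟨hf, C, hC⟩ := hf
  refine ⟨hf.const_mul c, ‖c‖ ^ 2 * C, fun r h0 h1 => ?_⟩
  have : (fun z => ‖c * f z‖ ^ 2) = (‖c‖ ^ 2) • (fun z => ‖f z‖ ^ 2) := by
    ext z
    simp [mul_pow]
  rw [this, Real.circleAverage_smul, smul_eq_mul]
  exact mul_le_mul_of_nonneg_left (hC r h0 h1) (by positivity)

/-- The part of the nontangential approach region of aperture `κ` at `ζ` that lies inside the
unit disk. -/
def stolzInside (κ : ℝ) (ζ : ℂ) : Set ℂ := {w | ‖w‖ < 1 ∧ ‖w - ζ‖ < κ * (1 - ‖w‖)}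

/-- The part of the nontangential approach region of aperture `κ` at `ζ` that lies outside the
closed unit disk. -/
def stolzOutside (κ : ℝ) (ζ : ℂ) : Set ℂ := {w | 1 < ‖w‖ ∧ ‖w - ζ‖ < κ * (‖w‖ - 1)}

/-- At the boundary point `ζ` the nontangential limits of `f` from inside and from outside the unit
disk both exist, and they are both equal to `a`. -/
def HasCommonNontangentialLimit (f : ℂ → ℂ) (ζ a : ℂ) : Prop :=
  ∀ κ : ℝ, 1 < κ → Tendsto f (𝓝[stolzInside κ ζ] ζ) (𝓝 a) ∧
    Tendsto f (𝓝[stolzOutside κ ζ] ζ) (𝓝 a)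

/-! ### Spectral subspaces of an operator -/

section Subspaces

variable {H : Type*} [NormedAddCommGroup H] [InnerProductSpace ℂ H]

/-- `(T - z)⁻¹ u`, for `z` in the resolvent set of `T`. -/
noncomputable def resolventVec (T : H →L[ℂ] H) (z : ℂ) (u : H) : H :=
  Ring.inverse (T - z • (1 : H →L[ℂ] H)) u

/-- `(I - z T)⁻¹ u`, for `z` such that `I - z T` is invertible. -/
noncomputable def coresolventVec (T : H →L[ℂ] H) (z : ℂ) (u : H) : H :=
  Ring.inverse (1 - z • T) u

/-- `z ↦ (T - z)⁻¹ u` is analytic in `D`: from the points of `D` that lie in the resolvent set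
of `T` it extends to an analytic function on `D`. -/
def ResolventAnalyticOn (T : H →L[ℂ] H) (u : H) (D : Set ℂ) : Prop :=
  ∃ F : ℂ → H, DifferentiableOn ℂ F D ∧
    ∀ z ∈ D, z ∈ resolventSet ℂ T → F z = resolventVec T z u

theorem ResolventAnalyticOn.zero (T : H →L[ℂ] H) (D : Set ℂ) : ResolventAnalyticOn T 0 D :=
  ⟨fun _ => 0, differentiableOn_const _, fun z _ _ => by simp [resolventVec]⟩

theorem ResolventAnalyticOn.add {T : H →L[ℂ] H} {u v : H} {D : Set ℂ}
    (hu : ResolventAnalyticOn T u D) (hv : ResolventAnalyticOn T v D) :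
    ResolventAnalyticOn T (u + v) D := by
  obtain ⟨F, hF, hF'⟩ := hu
  obtain ⟨G, hG, hG'⟩ := hv
  exact ⟨fun z => F z + G z, hF.add hG, fun z hz hz' => by
    simp only [hF' z hz hz', hG' z hz hz', resolventVec, map_add]⟩

theorem ResolventAnalyticOn.smul {T : H →L[ℂ] H} {u : H} {D : Set ℂ} (c : ℂ)
    (hu : ResolventAnalyticOn T u D) : ResolventAnalyticOn T (c • u) D := by
  obtain ⟨F, hF, hF'⟩ := hu
  exact ⟨fun z => c • F z, hF.const_smul c, fun z hz hz' => by
    simp only [hF' z hz hz', resolventVec, map_smul]⟩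

/-- The linear set `H̃₊ʷ(T)`, for `T` whose spectrum has no accumulation points off the unit
circle: the vectors `u` such that `(T - z)⁻¹ u` is analytic in the open unit disk and
`⟨(T - z)⁻¹ u, v⟩` is in `H²` for all `v`. -/
def weakPlus (T : H →L[ℂ] H) : Submodule ℂ H where
  carrier := {u | ResolventAnalyticOn T u (Metric.ball 0 1) ∧
    ∀ v : H, ∃ g : ℂ → ℂ, MemH2 g ∧
      ∀ z ∈ Metric.ball (0 : ℂ) 1, z ∈ resolventSet ℂ T → g z = inner ℂ v (resolventVec T z u)}
  zero_mem' := ⟨.zero T _, fun v => ⟨fun _ => 0, MemH2.zero, fun z _ _ => by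
    simp [resolventVec]⟩⟩
  add_mem' := by
    rintro a b ⟨ha, ha'⟩ ⟨hb, hb'⟩
    refine ⟨ha.add hb, fun v => ?_⟩
    obtain ⟨f, hf, hf'⟩ := ha' v
    obtain ⟨g, hg, hg'⟩ := hb' v
    exact ⟨_, hf.add hg, fun z hz hz' => by
      simp only [hf' z hz hz', hg' z hz hz', resolventVec, map_add, inner_add_right]⟩
  smul_mem' := by
    rintro c a ⟨ha, ha'⟩
    refine ⟨ha.smul c, fun v => ?_⟩
    obtain ⟨f, hf, hf'⟩ := ha' v
    exact ⟨_, hf.const_mul c, fun z hz hz' => by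
      simp only [hf' z hz hz', resolventVec, map_smul, inner_smul_right]⟩

/-- The linear set `H̃₋ʷ(T)`, for `T` whose spectrum has no accumulation points off the unit
circle: the vectors `u` such that `(T - z)⁻¹ u` is analytic outside the closed unit disk and
`⟨(I - z T)⁻¹ u, v⟩`, as a function of `z` in the open unit disk, is in `H²` for all `v`. -/
def weakMinus (T : H →L[ℂ] H) : Submodule ℂ H where
  carrier := {u | ResolventAnalyticOn T u (Metric.closedBall 0 1)ᶜ ∧
    ∀ v : H, ∃ g : ℂ → ℂ, MemH2 g ∧
      ∀ z ∈ Metric.ball (0 : ℂ) 1, IsUnit (1 - z • T) → g z = inner ℂ v (coresolventVec T z u)}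
  zero_mem' := ⟨.zero T _, fun v => ⟨fun _ => 0, MemH2.zero, fun z _ _ => by
    simp [coresolventVec]⟩⟩
  add_mem' := by
    rintro a b ⟨ha, ha'⟩ ⟨hb, hb'⟩
    refine ⟨ha.add hb, fun v => ?_⟩
    obtain ⟨f, hf, hf'⟩ := ha' v
    obtain ⟨g, hg, hg'⟩ := hb' v
    exact ⟨_, hf.add hg, fun z hz hz' => by
      simp only [hf' z hz hz', hg' z hz hz', coresolventVec, map_add, inner_add_right]⟩
  smul_mem' := by
    rintro c a ⟨ha, ha'⟩
    refine ⟨ha.smul c, fun v => ?_⟩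
    obtain ⟨f, hf, hf'⟩ := ha' v
    exact ⟨_, hf.const_mul c, fun z hz hz' => by
      simp only [hf' z hz hz', coresolventVec, map_smul, inner_smul_right]⟩

/-- The weak absolutely continuous subspace `H_acʷ(T) = Clos (H̃₊ʷ(T) ∩ H̃₋ʷ(T))`. -/
def weakAC (T : H →L[ℂ] H) : Submodule ℂ H := (weakPlus T ⊓ weakMinus T).topologicalClosure

/-- The subspace `CN(T) = Clos (H̃₊ʷ(T) ∨ H̃₋ʷ(T))`. -/
def CN (T : H →L[ℂ] H) : Submodule ℂ H := (weakPlus T ⊔ weakMinus T).topologicalClosure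

/-- The linear set of the vectors `u` such that, for all `v`, the nontangential limits of
`⟨(T - w)⁻¹ u, v⟩` from inside and from outside the unit disk exist and coincide at almost every
point of the unit circle. Here the spectrum of `T` is supposed to lie on the unit circle. -/
def singularVectors (T : H →L[ℂ] H) : Submodule ℂ H where
  carrier := {u | ∀ v : H, ∀ᵐ θ : ℝ, ∃ a : ℂ,
    HasCommonNontangentialLimit (fun w => inner ℂ v (resolventVec T w u)) (Circle.exp θ) a}
  zero_mem' := fun v => Eventually.of_forall fun θ => ⟨0, fun κ _ => by
    simp [resolventVec, tendsto_const_nhds]⟩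
  add_mem' := by
    intro a b ha hb v
    filter_upwards [ha v, hb v] with θ ⟨x, hx⟩ ⟨y, hy⟩
    refine ⟨x + y, fun κ hκ => ?_⟩
    simp only [resolventVec, map_add, inner_add_right]
    exact ⟨(hx κ hκ).1.add (hy κ hκ).1, (hx κ hκ).2.add (hy κ hκ).2⟩
  smul_mem' := by
    intro c a ha v
    filter_upwards [ha v] with θ ⟨x, hx⟩
    refine ⟨c * x, fun κ hκ => ?_⟩
    simp only [resolventVec, map_smul, inner_smul_right]
    exact ⟨(hx κ hκ).1.const_mul c, (hx κ hκ).2.const_mul c⟩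

/-- The singular subspace `H_s(T)`, for `T` with spectrum on the unit circle. -/
def singularSubspace (T : H →L[ℂ] H) : Submodule ℂ H := (singularVectors T).topologicalClosure

/-- The `n`-th singular number `μ_n(S)`, `n = 1, 2, …`, of a compact operator `S`: the `n`-th term
of the decreasing sequence of the nonzero eigenvalues of `(S* S)^{1/2}`, each repeated according to
its multiplicity, and `0` if there are fewer than `n` of them. (It is the largest `t > 0` such that
at least `n` eigenvalues, counted with multiplicity, are `≥ t`.) -/
noncomputable def singularNumber [CompleteSpace H] (S : H →L[ℂ] H) (n : ℕ) : ℝ :=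
  sSup {t : ℝ | 0 < t ∧ (n : Cardinal) ≤ Module.rank ℂ
    (⨆ s ∈ Ici t, Module.End.eigenspace ((S.adjoint ∘L S : H →L[ℂ] H) : Module.End ℂ H)
      ((s : ℂ) ^ 2) : Submodule ℂ H)}

end Subspaces

/-! ### The operator -/

/-- `ℓ²(ℤ)`. -/
abbrev L2Z : Type := lp (fun _ : ℤ => ℂ) 2

/-- The standard basis vector `e_n` of `ℓ²(ℤ)`. -/
noncomputable abbrev basisVec (n : ℤ) : L2Z := lp.single 2 n 1

theorem memℓp_shift (x : L2Z) : Memℓp (fun n : ℤ => x (n - 1)) 2 := by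
  have h := lp.memℓp x
  rw [memℓp_gen_iff (by norm_num)] at h ⊢
  exact h.comp_injective (sub_left_injective (b := (1 : ℤ)))

/-- The bilateral right shift on `ℓ²(ℤ)`. -/
noncomputable def shift : L2Z →L[ℂ] L2Z :=
  LinearMap.mkContinuous
    { toFun := fun x => ⟨fun n : ℤ => x (n - 1), memℓp_shift x⟩
      map_add' := fun _ _ => rfl
      map_smul' := fun _ _ => rfl } 1 (by
    intro x
    rw [one_mul, lp.norm_eq_tsum_rpow (by norm_num), lp.norm_eq_tsum_rpow (by norm_num)]
    refine le_of_eq (congrArg (fun s : ℝ => s ^ (1 / (2 : ENNReal).toReal)) ?_)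
    exact (Equiv.subRight (1 : ℤ)).tsum_eq fun n => ‖x n‖ ^ (2 : ENNReal).toReal)

@[simp] theorem shift_apply (x : L2Z) (n : ℤ) : shift x n = x (n - 1) := rfl

theorem shift_basisVec (n : ℤ) : shift (basisVec n) = basisVec (n + 1) := by
  ext m
  by_cases h : m = n + 1
  · subst h
    simp [lp.single_apply]
  · have : m - 1 ≠ n := fun h' => h (by omega)
    simp [lp.single_apply, h, this]

theorem abs_le_iSup_of_tendsto {ρ : ℕ → ℝ} (hρ : Tendsto ρ atTop (𝓝 0)) (n : ℕ) :
    |ρ n| ≤ ⨆ k, |ρ k| :=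
  le_ciSup hρ.abs.bddAbove_range n

/-- The diagonal operator `R e_n = ρ_{|n|} e_n` on `ℓ²(ℤ)`, for a sequence `ρ` tending to `0`. -/
noncomputable def diagOp (ρ : ℕ → ℝ) (hρ : Tendsto ρ atTop (𝓝 0)) : L2Z →L[ℂ] L2Z :=
  lp.mapCLM 2 (fun n : ℤ => ((ρ n.natAbs : ℝ) : ℂ) • ContinuousLinearMap.id ℂ ℂ)
    (K := ⨆ k, |ρ k|) ((abs_nonneg _).trans (abs_le_iSup_of_tendsto hρ 0)) (fun n => by
      rw [norm_smul, ContinuousLinearMap.norm_id, mul_one, Complex.norm_real, Real.norm_eq_abs]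
      exact abs_le_iSup_of_tendsto hρ n.natAbs)

@[simp] theorem diagOp_apply (ρ : ℕ → ℝ) (hρ : Tendsto ρ atTop (𝓝 0)) (x : L2Z) (n : ℤ) :
    diagOp ρ hρ x n = (ρ n.natAbs : ℂ) * x n := rfl

theorem diagOp_basisVec (ρ : ℕ → ℝ) (hρ : Tendsto ρ atTop (𝓝 0)) (n : ℤ) :
    diagOp ρ hρ (basisVec n) = ((ρ n.natAbs : ℝ) : ℂ) • basisVec n := by
  ext m
  rw [diagOp_apply, lp.coeFn_smul, Pi.smul_apply, smul_eq_mul]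
  by_cases h : m = n
  · subst h
    rfl
  · simp [lp.single_apply, h]

/-- The Hilbert space `ℓ²(ℤ) ⊕ ℓ²(ℤ)`. -/
abbrev L2Z2 : Type := WithLp 2 (L2Z × L2Z)

/-- The operator on `ℓ²(ℤ) ⊕ ℓ²(ℤ)` with the block matrix `[[A, B], [C, D]]`. -/
noncomputable def blockOp (A B C D : L2Z →L[ℂ] L2Z) : L2Z2 →L[ℂ] L2Z2 :=
  ((WithLp.prodContinuousLinearEquiv 2 ℂ L2Z L2Z).symm : L2Z × L2Z →L[ℂ] L2Z2) ∘L
    ((A ∘L WithLp.fstL 2 ℂ L2Z L2Z + B ∘L WithLp.sndL 2 ℂ L2Z L2Z).prod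
      (C ∘L WithLp.fstL 2 ℂ L2Z L2Z + D ∘L WithLp.sndL 2 ℂ L2Z L2Z))

@[simp] theorem blockOp_fst (A B C D : L2Z →L[ℂ] L2Z) (x : L2Z2) :
    (blockOp A B C D x).fst = A x.fst + B x.snd := rfl

@[simp] theorem blockOp_snd (A B C D : L2Z →L[ℂ] L2Z) (x : L2Z2) :
    (blockOp A B C D x).snd = C x.fst + D x.snd := rfl

/-- The operator `T = [[U, R], [0, U]]` on `ℓ²(ℤ) ⊕ ℓ²(ℤ)`. -/
noncomputable def dualOp (ρ : ℕ → ℝ) (hρ : Tendsto ρ atTop (𝓝 0)) : L2Z2 →L[ℂ] L2Z2 :=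
  blockOp shift (diagOp ρ hρ) 0 shift

/-- The subspace `ℓ²(ℤ) ⊕ 0` of `ℓ²(ℤ) ⊕ ℓ²(ℤ)`. -/
noncomputable def firstSummand : Submodule ℂ L2Z2 :=
  LinearMap.ker (WithLp.sndL 2 ℂ L2Z L2Z : L2Z2 →ₗ[ℂ] L2Z)

end SpectralDuality

/-!
The powers of `T` are explicit: `Tⁿ (x ⊕ y)` has second component `Uⁿ y`, and its first component at
`j + n` is `xⱼ + yⱼ₊₁ (ρ_|j+1| + ⋯ + ρ_|j+n|)`; negative powers behave in the same way. If all the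
functions `⟨(I - z T)⁻¹ u, v⟩` are in `H²`, their Taylor coefficients `⟨Tⁿ u, v⟩` are bounded in `n`
(`MemH2.exists_norm_coeff_le`), so that `‖Tⁿ u‖` is bounded by the uniform boundedness principle
(`exists_norm_pow_apply_le`). As `∑ ρₙ = ∞`, this is possible only for `y = 0`. The same holds for
`(T - z)⁻¹` and negative powers, so that `CN(T) ⊆ ℓ²(ℤ) ⊕ 0`. Conversely `T` acts on `ℓ²(ℤ) ⊕ 0` as
the bilateral shift, and for `u = e_m ⊕ 0` the Taylor coefficients are coordinates of `v`; so these
`u` are in both linear sets (`fstVec_mem_weakPlus`, `fstVec_mem_weakMinus`), which gives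
`H_acʷ(T) = CN(T) = ℓ²(ℤ) ⊕ 0`.

For `H_s(T*)`, the two components of a vector are tested in turn against `e₀ ⊕ 0` and `0 ⊕ e₀`, which
reduces the question to the scalar functions `⟨(U* - w)⁻¹ x, e₀⟩` of the bilateral shift. The
difference of the values of such a function at `r ζ` and at `ζ / r` is an Abel mean of the Fourier series with
coefficients `x₋ₖ₋₁` (`eq_zero_of_no_jump`). The Abel means converge in `L²` of the circle to the sum
of the series. If the nontangential limits from the two sides coincide almost everywhere, the
means tend to `0` almost everywhere, so that the sum is `0` and `x = 0`
(`eq_zero_of_abelMeans_tendsto_zero`). No theorem on the existence of boundary values is needed.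

The unitary part is `U ⊕ U`, and the compact part is `S (x ⊕ y) = R y ⊕ 0`; the operator `S* S` is
`0 ⊕ R²`, whose nonzero eigenvalues are `ρ₀²`, and `ρₖ²` twice for every `k ≥ 1` (with coincidences
if `ρ` repeats values).
-/

namespace SpectralDuality

/-! ### Invertibility and the spectrum -/

section Abstract

variable {H : Type*} [NormedAddCommGroup H] [InnerProductSpace ℂ H]

theorem inverse_apply_eq {A : H →L[ℂ] H} (hA : IsUnit A) {u w : H} (h : A w = u) :
    Ring.inverse A u = w := by
  rw [← h, ← mul_apply_eq_comp, Ring.inverse_mul_cancel A hA,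
    one_apply_eq_self]

theorem apply_inverse_apply {A : H →L[ℂ] H} (hA : IsUnit A) (u : H) :
    A (Ring.inverse A u) = u := by
  rw [← mul_apply_eq_comp, Ring.mul_inverse_cancel A hA,
    one_apply_eq_self]

theorem mem_resolventSet_iff_isUnit_sub {A : H →L[ℂ] H} {z : ℂ} :
    z ∈ resolventSet ℂ A ↔ IsUnit (A - z • (1 : H →L[ℂ] H)) := by
  rw [spectrum.mem_resolventSet_iff, ← IsUnit.neg_iff, neg_sub, Algebra.algebraMap_eq_smul_one]

theorem isUnit_sub_smul_of_mem_unitary [CompleteSpace H] {U : H →L[ℂ] H}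
    (hU : U ∈ unitary (H →L[ℂ] H)) {z : ℂ} (hz : ‖z‖ ≠ 1) :
    IsUnit (U - z • (1 : H →L[ℂ] H)) := by
  rw [← mem_resolventSet_iff_isUnit_sub]
  by_contra h
  exact hz (mem_sphere_zero_iff_norm.1 (spectrum.subset_circle_of_unitary hU h))

theorem isUnit_of_forall_isUnit_sub {A : H →L[ℂ] H}
    (hA : ∀ z : ℂ, ‖z‖ ≠ 1 → IsUnit (A - z • (1 : H →L[ℂ] H))) : IsUnit A := by
  simpa using hA 0 (by simp)

theorem isUnit_one_sub_smul {A : H →L[ℂ] H}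
    (hA : ∀ z : ℂ, ‖z‖ ≠ 1 → IsUnit (A - z • (1 : H →L[ℂ] H))) {z : ℂ} (hz : ‖z‖ < 1) :
    IsUnit (1 - z • A) := by
  rcases eq_or_ne z 0 with rfl | h0
  · simp
  have h1 : ‖z⁻¹‖ ≠ 1 := by
    rw [norm_inv]
    intro h
    rw [inv_eq_one] at h
    exact hz.ne h
  have : 1 - z • A = (Units.mk0 (-z) (neg_ne_zero.2 h0)) • (A - z⁻¹ • (1 : H →L[ℂ] H)) := by
    rw [Units.smul_def, Units.val_mk0, smul_sub, smul_smul, neg_mul, mul_inv_cancel₀ h0]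
    simp only [neg_smul, one_smul]
    abel
  rw [this]
  exact (hA _ h1).smul _

theorem mem_unitary_of_norm_map_of_surjective [CompleteSpace H] {U : H →L[ℂ] H}
    (h1 : ∀ x, ‖U x‖ = ‖x‖) (h2 : Function.Surjective U) : U ∈ unitary (H →L[ℂ] H) :=
  (Unitary.linearIsometryEquiv.symm
    (LinearIsometryEquiv.ofSurjective ⟨(U : H →ₗ[ℂ] H), h1⟩ h2)).2

end Abstract

/-! ### The shift and the block operator -/

theorem L2Z2_ext {x y : L2Z2} (h1 : x.fst = y.fst) (h2 : x.snd = y.snd) : x = y :=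
  (WithLp.equiv 2 (L2Z × L2Z)).injective (Prod.ext h1 h2)

theorem norm_shift (x : L2Z) : ‖shift x‖ = ‖x‖ := by
  rw [lp.norm_eq_tsum_rpow (by norm_num), lp.norm_eq_tsum_rpow (by norm_num)]
  refine congrArg (fun s : ℝ => s ^ (1 / (2 : ENNReal).toReal)) ?_
  exact (Equiv.subRight (1 : ℤ)).tsum_eq fun n => ‖x n‖ ^ (2 : ENNReal).toReal

theorem shift_surjective : Function.Surjective shift := by
  intro y
  have h : Memℓp (fun n : ℤ => y (n + 1)) 2 := by
    have h := lp.memℓp y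
    rw [memℓp_gen_iff (by norm_num)] at h ⊢
    exact h.comp_injective (add_left_injective (1 : ℤ))
  refine ⟨⟨_, h⟩, ?_⟩
  ext n
  exact congrArg y (sub_add_cancel n 1)

theorem shift_mem_unitary : shift ∈ unitary (L2Z →L[ℂ] L2Z) :=
  mem_unitary_of_norm_map_of_surjective norm_shift shift_surjective

theorem blockOp_shift_mem_unitary : blockOp shift 0 0 shift ∈ unitary (L2Z2 →L[ℂ] L2Z2) := by
  refine mem_unitary_of_norm_map_of_surjective (fun x => ?_) fun y => ?_
  · rw [← sq_eq_sq₀ (norm_nonneg _) (norm_nonneg _), WithLp.prod_norm_sq_eq_of_L2,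
      WithLp.prod_norm_sq_eq_of_L2, blockOp_fst, blockOp_snd]
    simp [norm_shift]
  · obtain ⟨a, ha⟩ := shift_surjective y.fst
    obtain ⟨b, hb⟩ := shift_surjective y.snd
    exact ⟨WithLp.toLp 2 (a, b), L2Z2_ext (by simp [ha]) (by simp [hb])⟩

theorem isUnit_shift_sub {z : ℂ} (hz : ‖z‖ ≠ 1) : IsUnit (shift - z • (1 : L2Z →L[ℂ] L2Z)) :=
  isUnit_sub_smul_of_mem_unitary shift_mem_unitary hz

section

variable (ρ : ℕ → ℝ) (hρ : Tendsto ρ atTop (𝓝 0))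

@[simp] theorem dualOp_fst (x : L2Z2) :
    (dualOp ρ hρ x).fst = shift x.fst + diagOp ρ hρ x.snd := rfl

@[simp] theorem dualOp_snd (x : L2Z2) : (dualOp ρ hρ x).snd = shift x.snd := by
  simp [dualOp]

/-- Off the unit circle the upper triangular operator `T - z` is inverted by the upper triangular
operator with the diagonal `B = (U - z)⁻¹` and the corner `-B R B`. -/
theorem isUnit_dualOp_sub {z : ℂ} (hz : ‖z‖ ≠ 1) :
    IsUnit (dualOp ρ hρ - z • (1 : L2Z2 →L[ℂ] L2Z2)) := by
  have hA := isUnit_shift_sub hz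
  set B := Ring.inverse (shift - z • (1 : L2Z →L[ℂ] L2Z))
  have hAB : ∀ x, shift (B x) - z • B x = x := fun x => apply_inverse_apply hA x
  have hBA : ∀ x, B (shift x - z • x) = x := fun x => inverse_apply_eq hA rfl
  refine ⟨⟨_, blockOp B (-(B ∘L diagOp ρ hρ ∘L B)) 0 B, ?_, ?_⟩, rfl⟩
  · refine ContinuousLinearMap.ext fun x => L2Z2_ext ?_ ?_
    · simp only [mul_apply_eq_comp, sub_apply, WithLp.sub_fst,
        dualOp_fst, blockOp_fst, blockOp_snd, smul_apply, WithLp.smul_fst,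
        one_apply_eq_self, zero_apply, zero_add,
        neg_apply, ContinuousLinearMap.comp_apply]
      rw [← map_neg B, ← map_add B, add_sub_right_comm, hAB]
      abel
    · simp only [mul_apply_eq_comp, sub_apply, WithLp.sub_snd,
        dualOp_snd, blockOp_snd, smul_apply, WithLp.smul_snd,
        one_apply_eq_self, zero_apply, zero_add]
      exact hAB _
  · refine ContinuousLinearMap.ext fun x => L2Z2_ext ?_ ?_
    · simp only [mul_apply_eq_comp, sub_apply, WithLp.sub_fst,
        WithLp.sub_snd, dualOp_fst, dualOp_snd, blockOp_fst, smul_apply,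
        WithLp.smul_fst, WithLp.smul_snd, one_apply_eq_self,
        neg_apply, ContinuousLinearMap.comp_apply]
      rw [add_sub_right_comm, map_add, hBA, hBA]
      abel
    · simp only [mul_apply_eq_comp, sub_apply, WithLp.sub_snd,
        dualOp_snd, blockOp_snd, smul_apply, WithLp.smul_snd,
        one_apply_eq_self, zero_apply, zero_add]
      exact hBA _

theorem isUnit_one_sub_smul_dualOp {z : ℂ} (hz : ‖z‖ < 1) : IsUnit (1 - z • dualOp ρ hρ) :=
  isUnit_one_sub_smul (fun _ h => isUnit_dualOp_sub ρ hρ h) hz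

theorem summable_norm_sq (x : L2Z) : Summable fun n : ℤ => ‖x n‖ ^ 2 := by
  simpa using (memℓp_gen_iff (by norm_num)).1 (lp.memℓp x)

theorem tendsto_coord_of_injective (x : L2Z) {f : ℕ → ℤ} (hf : f.Injective) :
    Tendsto (fun n => ‖x (f n)‖) atTop (𝓝 0) := by
  have h := ((summable_norm_sq x).comp_injective hf).tendsto_atTop_zero.sqrt
  simpa [Function.comp_def, Real.sqrt_sq] using h

/-- A solution of `(U - z) x = e₀` with `|z| = 1` would have constant modulus on each half line. -/
theorem shift_sub_smul_ne_basisVec {z : ℂ} (hz : ‖z‖ = 1) (x : L2Z) :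
    shift x - z • x ≠ basisVec 0 := by
  intro h
  have hc : ∀ n : ℤ, x (n - 1) - z * x n = basisVec 0 n := fun n => congrArg (fun y : L2Z => y n) h
  have hn : ∀ n : ℤ, n ≠ 0 → ‖x (n - 1)‖ = ‖x n‖ := fun n h0 => by
    have := hc n
    rw [lp.single_apply_ne _ _ _ h0, sub_eq_zero] at this
    rw [this, norm_mul, hz, one_mul]
  have h1 : ∀ n : ℕ, ‖x n‖ = ‖x 0‖ := fun n => by
    induction n with
    | zero => rfl
    | succ k ih =>
      rw [← ih, ← hn _ (by positivity)]
      simp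
  have h2 : ∀ n : ℕ, ‖x (-1 - n)‖ = ‖x (-1)‖ := fun n => by
    induction n with
    | zero => simp
    | succ k ih =>
      rw [← ih, ← hn (-1 - k) (by omega)]
      exact congrArg (fun j : ℤ => ‖x j‖) (by push_cast; ring)
  have h3 : ‖x 0‖ = 0 := tendsto_nhds_unique (by simp [h1])
    (tendsto_coord_of_injective x (f := fun n => n) Nat.cast_injective)
  have h4 : ‖x (-1)‖ = 0 := tendsto_nhds_unique (by simp [h2])
    (tendsto_coord_of_injective x (f := fun n => -1 - n) fun a b h => by simpa using h)
  have := hc 0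
  rw [norm_eq_zero.1 h3, zero_sub, norm_eq_zero.1 h4, lp.single_apply_self] at this
  simp at this

theorem spectrum_dualOp : spectrum ℂ (dualOp ρ hρ) = Metric.sphere (0 : ℂ) 1 := by
  ext z
  rw [mem_sphere_zero_iff_norm, ← not_iff_not]
  change ¬ ¬ (z ∈ resolventSet ℂ (dualOp ρ hρ)) ↔ _
  rw [not_not, mem_resolventSet_iff_isUnit_sub]
  refine ⟨fun h hz => ?_, fun h => isUnit_dualOp_sub ρ hρ h⟩
  have := apply_inverse_apply h (WithLp.toLp 2 (0, basisVec 0))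
  refine shift_sub_smul_ne_basisVec hz
    (Ring.inverse (dualOp ρ hρ - z • (1 : L2Z2 →L[ℂ] L2Z2)) (WithLp.toLp 2 (0, basisVec 0))).snd ?_
  simpa using congrArg (fun y : L2Z2 => y.snd) this

end

/-! ### Orbits of a vector with square integrable resolvent are bounded -/

/-- The Taylor coefficients of a function of class `H²` are bounded: by Cauchy's estimate on the
circle of radius `r`, the `n`-th one is at most `r⁻ⁿ` times the mean of `|g| ≤ 1 + |g|²`. -/
theorem MemH2.exists_norm_coeff_le {g : ℂ → ℂ} (hg : MemH2 g) {a : ℕ → ℂ}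
    (ha : ∀ᶠ z in 𝓝 (0 : ℂ), HasSum (fun n => z ^ n * a n) (g z)) : ∃ C : ℝ, ∀ n, ‖a n‖ ≤ C := by
  obtain ⟨hd, C, hC⟩ := hg
  refine ⟨1 + C, fun n => ?_⟩
  have hq : HasFPowerSeriesAt g (FormalMultilinearSeries.ofScalars ℂ a) 0 := by
    rw [hasFPowerSeriesAt_iff]
    filter_upwards [ha] with z hz
    simpa [FormalMultilinearSeries.coeff_ofScalars] using hz
  have key : ∀ r ∈ Ioo (0 : ℝ) 1, ‖a n‖ ≤ (1 + C) * r⁻¹ ^ n := by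
    rintro r ⟨h0, h1⟩
    have hsub : Metric.closedBall (0 : ℂ) ((⟨r, h0.le⟩ : NNReal) : ℝ) ⊆ Metric.ball 0 1 :=
      Metric.closedBall_subset_ball h1
    have hp := ((hd.mono hsub).hasFPowerSeriesOnBall (NNReal.coe_pos.1 h0)).hasFPowerSeriesAt
    have hcoef : ‖a n‖ = ‖cauchyPowerSeries g 0 r n‖ := by
      have heq : cauchyPowerSeries g 0 r = FormalMultilinearSeries.ofScalars ℂ a :=
        hp.eq_formalMultilinearSeries hq
      rw [heq, FormalMultilinearSeries.norm_apply_eq_norm_coef,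
        FormalMultilinearSeries.coeff_ofScalars]
    have hcont : ContinuousOn g (Metric.sphere 0 r) :=
      hd.continuousOn.mono fun z hz => hsub (Metric.sphere_subset_closedBall hz)
    have hmean : Real.circleAverage (fun z => ‖g z‖) 0 r ≤ 1 + C := by
      refine (Real.circleAverage_mono (hcont.norm.circleIntegrable h0.le)
        ((circleIntegrable_const (1 : ℝ) 0 r).add (MemH2.circleIntegrable hd h0.le h1))
        fun z _ => ?_).trans ?_
      · change ‖g z‖ ≤ 1 + ‖g z‖ ^ 2
        nlinarith [sq_nonneg (‖g z‖ - 1)]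
      · rw [Real.circleAverage_add (circleIntegrable_const (1 : ℝ) 0 r)
          (MemH2.circleIntegrable hd h0.le h1), Real.circleAverage_const]
        linarith [hC r h0.le h1]
    rw [hcoef]
    refine (norm_cauchyPowerSeries_le g 0 r n).trans ?_
    rw [abs_of_pos h0]
    exact mul_le_mul_of_nonneg_right hmean (by positivity)
  have hlim : Tendsto (fun r : ℝ => (1 + C) * r⁻¹ ^ n) (𝓝[<] 1) (𝓝 ((1 + C) * (1 : ℝ)⁻¹ ^ n)) :=
    tendsto_nhdsWithin_of_tendsto_nhds
      (((continuousAt_inv₀ one_ne_zero).pow n).const_mul (1 + C)).tendsto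
  rw [inv_one, one_pow, mul_one] at hlim
  exact ge_of_tendsto hlim
    (eventually_of_mem (Ioo_mem_nhdsLT zero_lt_one) key)

section Abstract

variable {H : Type*} [NormedAddCommGroup H] [InnerProductSpace ℂ H] [CompleteSpace H]

/-- By the uniform boundedness principle, a vector `u` for which all the functions
`⟨(I - z A)⁻¹ u, v⟩` are in `H²` has a bounded orbit under `A`. -/
theorem exists_norm_pow_apply_le {A : H →L[ℂ] H} {u : H}
    (h : ∀ v : H, ∃ g : ℂ → ℂ, MemH2 g ∧
      ∀ᶠ z in 𝓝 (0 : ℂ), g z = inner ℂ v (coresolventVec A z u)) :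
    ∃ C : ℝ, ∀ n : ℕ, ‖(A ^ n) u‖ ≤ C := by
  have hv : ∀ v : H, ∃ C, ∀ n : ℕ, ‖innerSL ℂ ((A ^ n) u) v‖ ≤ C := fun v => by
    obtain ⟨g, hg, hgv⟩ := h v
    have hN := hasFPowerSeriesAt_iff.1
      (spectrum.hasFPowerSeriesOnBall_inverse_one_sub_smul ℂ A).hasFPowerSeriesAt
    have hs : ∀ᶠ z in 𝓝 (0 : ℂ), HasSum (fun n => z ^ n * inner ℂ v ((A ^ n) u)) (g z) := by
      filter_upwards [hN, hgv] with z hz hgz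
      have := hz.mapL (innerSL ℂ v ∘L ContinuousLinearMap.apply ℂ H u)
      rw [hgz, coresolventVec]
      simpa [FormalMultilinearSeries.coeff] using this
    obtain ⟨C, hC⟩ := hg.exists_norm_coeff_le hs
    exact ⟨C, fun n => by rw [innerSL_apply_apply, norm_inner_symm]; exact hC n⟩
  obtain ⟨C, hC⟩ := banach_steinhaus hv
  exact ⟨C, fun n => by simpa using hC n⟩

theorem weakMinus_bounded_orbit {A : H →L[ℂ] H}
    (hA : ∀ z : ℂ, ‖z‖ ≠ 1 → IsUnit (A - z • (1 : H →L[ℂ] H))) {u : H} (hu : u ∈ weakMinus A) :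
    ∃ C : ℝ, ∀ n : ℕ, ‖(A ^ n) u‖ ≤ C := by
  refine exists_norm_pow_apply_le fun v => ?_
  obtain ⟨g, hg, hgv⟩ := hu.2 v
  refine ⟨g, hg, ?_⟩
  filter_upwards [Metric.ball_mem_nhds (0 : ℂ) one_pos] with z hz
  exact hgv z hz (isUnit_one_sub_smul hA (mem_ball_zero_iff.1 hz))

theorem weakPlus_bounded_orbit {A : H →L[ℂ] H}
    (hA : ∀ z : ℂ, ‖z‖ ≠ 1 → IsUnit (A - z • (1 : H →L[ℂ] H))) {u : H} (hu : u ∈ weakPlus A) :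
    ∃ C : ℝ, ∀ n : ℕ, ‖(Ring.inverse A ^ n) (Ring.inverse A u)‖ ≤ C := by
  have h0 := isUnit_of_forall_isUnit_sub hA
  refine exists_norm_pow_apply_le fun v => ?_
  obtain ⟨g, hg, hgv⟩ := hu.2 v
  refine ⟨g, hg, ?_⟩
  filter_upwards [Metric.ball_mem_nhds (0 : ℂ) one_pos] with z hz
  have hz1 := hA z (mem_ball_zero_iff.1 hz).ne
  rw [hgv z hz (mem_resolventSet_iff_isUnit_sub.2 hz1)]
  congr 1
  -- `(A - z)⁻¹ = (1 - z A⁻¹)⁻¹ A⁻¹`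
  have hfac : 1 - z • Ring.inverse A = Ring.inverse A * (A - z • (1 : H →L[ℂ] H)) := by
    rw [mul_sub, Ring.inverse_mul_cancel A h0, mul_smul_comm, mul_one]
  refine (inverse_apply_eq ?_ ?_).symm
  · rw [hfac]
    exact h0.ringInverse.mul hz1
  · rw [hfac, mul_apply_eq_comp, resolventVec, apply_inverse_apply hz1]

end Abstract

/-! ### Unbounded orbits of `T` -/

/-- The sums of `ρ` over the longer and longer windows that start at `c` grow without bound. -/
theorem tendsto_sum_natAbs_add {ρ : ℕ → ℝ} (hpos : ∀ n, 0 < ρ n) (hmono : Antitone ρ)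
    (hsum : ¬ Summable ρ) (c : ℤ) :
    Tendsto (fun n => ∑ k ∈ Finset.range n, ρ (c + k).natAbs) atTop atTop := by
  rw [← not_summable_iff_tendsto_nat_atTop_of_nonneg fun k => (hpos _).le]
  intro h
  refine hsum ((summable_nat_add_iff c.natAbs).1 (Summable.of_nonneg_of_le (fun k => (hpos _).le)
    (fun k => hmono ?_) h))
  omega

theorem norm_fst_apply_le (x : L2Z2) (j : ℤ) : ‖x.fst j‖ ≤ ‖x‖ :=
  (lp.norm_apply_le_norm two_ne_zero _ _).trans (WithLp.norm_fst_le _ x)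

theorem eq_zero_of_bounded_growth {a b : ℂ} {C : ℝ} {s : ℕ → ℝ} (hs : Tendsto s atTop atTop)
    (h : ∀ n, ‖a + b * s n‖ ≤ C) : b = 0 := by
  by_contra hb
  have hb' := norm_pos_iff.2 hb
  obtain ⟨n, hn⟩ := (hs.eventually_gt_atTop ((C + ‖a‖) / ‖b‖)).exists
  have h1 : ‖b * s n‖ ≤ C + ‖a‖ := by
    calc ‖b * s n‖ = ‖(a + b * s n) - a‖ := by rw [add_sub_cancel_left]
      _ ≤ ‖a + b * s n‖ + ‖a‖ := norm_sub_le _ _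
      _ ≤ C + ‖a‖ := by gcongr; exact h n
  rw [norm_mul, Complex.norm_real, Real.norm_eq_abs] at h1
  rw [div_lt_iff₀ hb'] at hn
  nlinarith [le_abs_self (s n)]

section

variable {ρ : ℕ → ℝ} (hρ : Tendsto ρ atTop (𝓝 0))

/-- Along a forward orbit the coordinate `yⱼ₊₁` of the second component is carried along by the
shift, and it adds `ρ_|j+1+k| yⱼ₊₁` to the same moving coordinate of the first component at each
step. -/
theorem snd_eq_zero_of_forward_orbit_bounded (hpos : ∀ n, 0 < ρ n) (hmono : Antitone ρ)
    (hsum : ¬ Summable ρ) {w : ℕ → L2Z2} (hw : ∀ n, w (n + 1) = dualOp ρ hρ (w n)) {C : ℝ}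
    (hC : ∀ n, ‖w n‖ ≤ C) : (w 0).snd = 0 := by
  have hy : ∀ (n : ℕ) (m : ℤ), (w n).snd (m + n) = (w 0).snd m := fun n => by
    induction n with
    | zero => simp
    | succ n ih =>
      intro m
      rw [hw, dualOp_snd, shift_apply, ← ih m]
      exact congrArg (fun i : ℤ => (w n).snd i) (by push_cast; ring)
  have hx : ∀ (n : ℕ) (j : ℤ), (w n).fst (j + n) = (w 0).fst j +
      (w 0).snd (j + 1) * (∑ k ∈ Finset.range n, ρ (j + 1 + k).natAbs : ℝ) := fun n => by
    induction n with
    | zero => simp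
    | succ n ih =>
      intro j
      have e1 : j + ((n + 1 : ℕ) : ℤ) = j + n + 1 := by push_cast; ring
      have e2 : j + n + 1 = j + 1 + n := by ring
      rw [hw, dualOp_fst, lp.coeFn_add, Pi.add_apply, shift_apply, diagOp_apply, e1,
        add_sub_cancel_right, ih, e2, hy, Finset.sum_range_succ]
      push_cast
      ring
  ext m
  refine eq_zero_of_bounded_growth (tendsto_sum_natAbs_add hpos hmono hsum m)
    (a := (w 0).fst (m - 1)) (C := C) fun n => ?_
  have := (norm_fst_apply_le (w n) (m - 1 + n)).trans (hC n)
  rwa [hx, sub_add_cancel] at this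

/-- The backward analogue: going back one step moves the coordinates to the left, and it subtracts
`ρ_|j-k| yⱼ₊₁` from the moving coordinate of the first component. -/
theorem snd_eq_zero_of_backward_orbit_bounded (hpos : ∀ n, 0 < ρ n) (hmono : Antitone ρ)
    (hsum : ¬ Summable ρ) {w : ℕ → L2Z2} (hw : ∀ n, dualOp ρ hρ (w (n + 1)) = w n) {C : ℝ}
    (hC : ∀ n, ‖w n‖ ≤ C) : (w 0).snd = 0 := by
  have hy : ∀ (n : ℕ) (m : ℤ), (w n).snd (m - n) = (w 0).snd m := fun n => by
    induction n with
    | zero => simp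
    | succ n ih =>
      intro m
      rw [← ih m, ← hw n, dualOp_snd, shift_apply]
      exact congrArg (fun i : ℤ => (w (n + 1)).snd i) (by push_cast; ring)
  have hx : ∀ (n : ℕ) (j : ℤ), (w n).fst (j - n) = (w 0).fst j +
      -(w 0).snd (j + 1) * (∑ k ∈ Finset.range n, ρ (-j + k).natAbs : ℝ) := fun n => by
    induction n with
    | zero => simp
    | succ n ih =>
      intro j
      have h1 := ih j
      have e1 : j - ((n + 1 : ℕ) : ℤ) = j - n - 1 := by push_cast; ring
      have e2 : j - n = j + 1 - ((n + 1 : ℕ) : ℤ) := by push_cast; ring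
      have e3 : (-j + n).natAbs = (j - n).natAbs := by omega
      rw [← hw n, dualOp_fst, lp.coeFn_add, Pi.add_apply, shift_apply, diagOp_apply] at h1
      have h2 : (w (n + 1)).snd (j - n) = (w 0).snd (j + 1) := by rw [e2, hy]
      rw [h2] at h1
      rw [e1, Finset.sum_range_succ, e3, eq_sub_of_add_eq h1]
      push_cast
      ring
  ext m
  refine neg_eq_zero.1 (eq_zero_of_bounded_growth
    (tendsto_sum_natAbs_add hpos hmono hsum (-(m - 1)))
    (a := (w 0).fst (m - 1)) (C := C) fun n => ?_)
  have := (norm_fst_apply_le (w n) (m - 1 - n)).trans (hC n)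
  rwa [hx, sub_add_cancel] at this

theorem mem_firstSummand {x : L2Z2} : x ∈ firstSummand ↔ x.snd = 0 := Iff.rfl

theorem weakMinus_le_firstSummand (hpos : ∀ n, 0 < ρ n) (hmono : Antitone ρ)
    (hsum : ¬ Summable ρ) : weakMinus (dualOp ρ hρ) ≤ firstSummand := by
  intro u hu
  obtain ⟨C, hC⟩ := weakMinus_bounded_orbit (fun z hz => isUnit_dualOp_sub ρ hρ hz) hu
  exact snd_eq_zero_of_forward_orbit_bounded hρ hpos hmono hsum
    (w := fun n => (dualOp ρ hρ ^ n) u) (fun n => by rw [pow_succ', mul_apply_eq_comp]) hC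

theorem weakPlus_le_firstSummand (hpos : ∀ n, 0 < ρ n) (hmono : Antitone ρ)
    (hsum : ¬ Summable ρ) : weakPlus (dualOp ρ hρ) ≤ firstSummand := by
  intro u hu
  have hA := fun (z : ℂ) (hz : ‖z‖ ≠ 1) => isUnit_dualOp_sub ρ hρ hz
  have h0 := isUnit_of_forall_isUnit_sub hA
  obtain ⟨C, hC⟩ := weakPlus_bounded_orbit hA hu
  have h := snd_eq_zero_of_backward_orbit_bounded hρ hpos hmono hsum
    (w := fun n => (Ring.inverse (dualOp ρ hρ) ^ n) (Ring.inverse (dualOp ρ hρ) u))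
    (fun n => by rw [pow_succ', mul_apply_eq_comp, apply_inverse_apply h0]) hC
  rw [mem_firstSummand, ← apply_inverse_apply h0 u, dualOp_snd]
  have h' : (Ring.inverse (dualOp ρ hρ) u).snd = 0 := h
  rw [h', map_zero]

theorem isClosed_firstSummand : IsClosed (firstSummand : Set L2Z2) :=
  (WithLp.sndL 2 ℂ L2Z L2Z).isClosed_ker

theorem CN_le_firstSummand (hpos : ∀ n, 0 < ρ n) (hmono : Antitone ρ) (hsum : ¬ Summable ρ) :
    CN (dualOp ρ hρ) ≤ firstSummand :=
  Submodule.topologicalClosure_minimal _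
    (sup_le (weakPlus_le_firstSummand hρ hpos hmono hsum)
      (weakMinus_le_firstSummand hρ hpos hmono hsum)) isClosed_firstSummand

end

/-! ### Fourier series on the circle -/

section Fourier

open MeasureTheory AddCircle

local instance fact_two_pi_pos : Fact (0 < 2 * Real.pi) := ⟨Real.two_pi_pos⟩

theorem fourier_coe_eq_exp_zpow (k : ℤ) (θ : ℝ) :
    fourier k (θ : AddCircle (2 * Real.pi)) = (Circle.exp θ : ℂ) ^ k := by
  rw [fourier_coe_apply, Circle.coe_exp, ← Complex.exp_int_mul]
  congr 1
  push_cast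
  have : (2 * Real.pi : ℂ) ≠ 0 := by exact_mod_cast Real.two_pi_pos.ne'
  field_simp

/-- The function in `L²` of the circle with the summable Fourier coefficients `y` is the sum of its
Fourier series. -/
theorem fourierBasis_repr_symm_ae_eq {y : L2Z} (hy : Summable fun k => ‖y k‖) :
    ((fourierBasis.repr.symm y : Lp ℂ 2 (@haarAddCircle (2 * Real.pi) _)) :
      AddCircle (2 * Real.pi) → ℂ) =ᵐ[haarAddCircle] fun t => ∑' k : ℤ, y k * fourier k t := by
  have hs : Summable fun k : ℤ => y k • (fourier k : C(AddCircle (2 * Real.pi), ℂ)) := by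
    refine Summable.of_norm ?_
    simpa only [norm_smul, fourier_norm, mul_one] using hy
  have h1 := hs.hasSum.mapL (ContinuousMap.toLp (E := ℂ) 2 (@haarAddCircle (2 * Real.pi) _) ℂ)
  have h2 := fourierBasis.hasSum_repr_symm (𝕜 := ℂ) (E := Lp ℂ 2 (@haarAddCircle (2 * Real.pi) _)) y
  rw [coe_fourierBasis] at h2
  simp only [map_smul] at h1
  rw [h2.unique h1]
  refine (ContinuousMap.coeFn_toLp (𝕜 := ℂ) _ _).trans (Eventually.of_forall fun t => ?_)
  have h3 := hs.hasSum.mapL (ContinuousMap.evalCLM ℂ t)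
  exact h3.tsum_eq.symm

/-- Parseval's identity, for an absolutely convergent Fourier series. -/
theorem integral_norm_sq_exp_series {y : L2Z} (hy : Summable fun k => ‖y k‖) :
    (2 * Real.pi)⁻¹ * ∫ θ in (0 : ℝ)..2 * Real.pi, ‖∑' k : ℤ, y k * (Circle.exp θ : ℂ) ^ k‖ ^ 2 =
      ∑' k : ℤ, ‖y k‖ ^ 2 := by
  have h1 := tsum_sq_fourierCoeff
    (fourierBasis.repr.symm y : Lp ℂ 2 (@haarAddCircle (2 * Real.pi) _))
  simp only [← fourierBasis_repr, LinearIsometryEquiv.apply_symm_apply] at h1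
  have h2 := AddCircle.intervalIntegral_preimage (2 * Real.pi) 0
    (fun t => ‖∑' k : ℤ, y k * fourier k t‖ ^ 2)
  simp only [fourier_coe_eq_exp_zpow, zero_add] at h2
  rw [h1, h2, ← smul_eq_mul, ← integral_haarAddCircle]
  refine integral_congr_ae ?_
  filter_upwards [fourierBasis_repr_symm_ae_eq hy] with t ht
  rw [ht]

theorem summable_pow_natAbs {r : ℝ} (h0 : 0 ≤ r) (h1 : r < 1) :
    Summable fun k : ℤ => r ^ k.natAbs := by
  refine Summable.of_nat_of_neg ?_ ?_ <;> simpa using summable_geometric_of_lt_one h0 h1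

/-- The sequence `(r^|k| yₖ)`, of the Fourier coefficients of the `r`-th Abel mean of the Fourier
series with coefficients `y`. -/
noncomputable def abelCoeff (r : Ioo (0 : ℝ) 1) (y : L2Z) : L2Z :=
  diagOp (fun n => (r : ℝ) ^ n) (tendsto_pow_atTop_nhds_zero_of_lt_one r.2.1.le r.2.2) y

theorem abelCoeff_apply (r : Ioo (0 : ℝ) 1) (y : L2Z) (k : ℤ) :
    abelCoeff r y k = (r : ℂ) ^ k.natAbs * y k := by
  rw [abelCoeff, diagOp_apply, Complex.ofReal_pow]

theorem summable_norm_abelCoeff (r : Ioo (0 : ℝ) 1) (y : L2Z) :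
    Summable fun k => ‖abelCoeff r y k‖ := by
  refine Summable.of_nonneg_of_le (fun k => norm_nonneg _) (fun k => ?_)
    ((summable_pow_natAbs r.2.1.le r.2.2).mul_right ‖y‖)
  rw [abelCoeff_apply, norm_mul, norm_pow, Complex.norm_real, Real.norm_of_nonneg r.2.1.le]
  exact mul_le_mul_of_nonneg_left (lp.norm_apply_le_norm two_ne_zero _ _) (pow_nonneg r.2.1.le _)

theorem norm_sq_eq_tsum (x : L2Z) : ‖x‖ ^ 2 = ∑' k, ‖x k‖ ^ 2 := by
  simpa using lp.norm_rpow_eq_tsum (by norm_num) x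

theorem tendsto_abelCoeff {r : ℕ → Ioo (0 : ℝ) 1} (hr : Tendsto (fun j => (r j : ℝ)) atTop (𝓝 1))
    (y : L2Z) : Tendsto (fun j => abelCoeff (r j) y) atTop (𝓝 y) := by
  rw [tendsto_iff_norm_sub_tendsto_zero]
  have h : Tendsto (fun j => ‖abelCoeff (r j) y - y‖ ^ 2) atTop (𝓝 0) := by
    simp only [norm_sq_eq_tsum]
    rw [← tsum_zero (β := ℤ)]
    refine tendsto_tsum_of_dominated_convergence (summable_norm_sq y) (fun k => ?_)
      (Eventually.of_forall fun j k => ?_)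
    · have h1 : Tendsto (fun j => ((r j : ℝ) : ℂ) ^ k.natAbs * y k - y k) atTop
          (𝓝 (((1 : ℝ) : ℂ) ^ k.natAbs * y k - y k)) :=
        (((Complex.continuous_ofReal.tendsto 1).comp hr).pow _ |>.mul_const _).sub_const _
      have h2 := (h1.norm).pow 2
      simp only [lp.coeFn_sub, Pi.sub_apply, abelCoeff_apply]
      simpa using h2
    · have h1 : abelCoeff (r j) y k - y k = -(((1 - (r j : ℝ) ^ k.natAbs : ℝ) : ℂ) * y k) := by
        rw [abelCoeff_apply]
        push_cast
        ring
      have h2 : (r j : ℝ) ^ k.natAbs ≤ 1 := pow_le_one₀ (r j).2.1.le (r j).2.2.le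
      have h3 : 0 ≤ (r j : ℝ) ^ k.natAbs := pow_nonneg (r j).2.1.le _
      simp only [lp.coeFn_sub, Pi.sub_apply]
      rw [Real.norm_of_nonneg (sq_nonneg _), h1, norm_neg, norm_mul, Complex.norm_real,
        Real.norm_of_nonneg (sub_nonneg.2 h2)]
      exact pow_le_pow_left₀ (mul_nonneg (by linarith) (norm_nonneg _))
        (mul_le_of_le_one_left (norm_nonneg _) (by linarith)) 2
  simpa [Real.sqrt_sq] using h.sqrt

/-- A function in `L²` of the circle vanishes if the Abel means of its Fourier series tend to `0`
almost everywhere. -/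
theorem eq_zero_of_abelMeans_tendsto_zero {y : L2Z}
    (h : ∀ᵐ θ : ℝ, Tendsto (fun r : Ioo (0 : ℝ) 1 =>
      ∑' k : ℤ, abelCoeff r y k * (Circle.exp θ : ℂ) ^ k)
        (comap Subtype.val (𝓝 (1 : ℝ))) (𝓝 0)) : y = 0 := by
  set r : ℕ → Ioo (0 : ℝ) 1 := fun j => ⟨1 - 1 / ((j : ℝ) + 2), by
    have : (0 : ℝ) < (j : ℝ) + 2 := by positivity
    constructor
    · rw [sub_pos, div_lt_one this]
      linarith [(Nat.cast_nonneg j : (0 : ℝ) ≤ j)]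
    · linarith [one_div_pos.2 this]⟩ with hrdef
  have hr : Tendsto (fun j => (r j : ℝ)) atTop (𝓝 1) := by
    have h1 : Tendsto (fun j : ℕ => (j : ℝ) + 2) atTop atTop :=
      tendsto_atTop_add_const_right _ _ tendsto_natCast_atTop_atTop
    simpa [hrdef] using (h1.inv_tendsto_atTop).const_sub 1
  set Φ : L2Z → Lp ℂ 2 (@haarAddCircle (2 * Real.pi) _) := fun x => fourierBasis.repr.symm x
  have hΦ : Tendsto (fun j => Φ (abelCoeff (r j) y)) atTop (𝓝 (Φ y)) :=
    (fourierBasis.repr.symm.continuous.tendsto y).comp (tendsto_abelCoeff hr y)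
  obtain ⟨ns, hns, hae⟩ := (tendstoInMeasure_of_tendsto_Lp hΦ).exists_seq_tendsto_ae
  have hae' : ∀ᵐ t ∂(@haarAddCircle (2 * Real.pi) _), ∀ j, Φ (abelCoeff (r j) y) t =
      ∑' k : ℤ, abelCoeff (r j) y k * fourier k t :=
    ae_all_iff.2 fun j => fourierBasis_repr_symm_ae_eq (summable_norm_abelCoeff (r j) y)
  have hac : (volume : Measure (AddCircle (2 * Real.pi))) ≪ haarAddCircle := by
    rw [volume_eq_smul_haarAddCircle]
    exact Measure.smul_absolutelyContinuous
  have hmp := AddCircle.measurePreserving_mk (2 * Real.pi) 0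
  have hzero : ∀ᵐ θ : ℝ ∂(volume.restrict (Ioc 0 (0 + 2 * Real.pi))),
      Φ y (θ : AddCircle (2 * Real.pi)) = 0 := by
    have hae1 := hmp.quasiMeasurePreserving.tendsto_ae.eventually (hac.ae_le hae)
    have hae2 := hmp.quasiMeasurePreserving.tendsto_ae.eventually (hac.ae_le hae')
    filter_upwards [hae1, hae2, ae_restrict_of_ae h] with θ h1 h2 h3
    refine tendsto_nhds_unique h1 ?_
    -- the subsequence that converges almost everywhere to `Φ y` also tends to `0`
    have h4 : Tendsto (fun j => r (ns j)) atTop (comap Subtype.val (𝓝 (1 : ℝ))) :=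
      tendsto_comap_iff.2 (hr.comp hns.tendsto_atTop)
    refine (h3.comp h4).congr fun j => ?_
    rw [h2 (ns j)]
    simp only [fourier_coe_eq_exp_zpow, Function.comp_apply]
  have hzero' : ∀ᵐ t ∂(volume : Measure (AddCircle (2 * Real.pi))), Φ y t = 0 := by
    rw [← hmp.map_eq, ae_map_iff hmp.measurable.aemeasurable]
    · exact hzero
    · exact (Lp.stronglyMeasurable (Φ y)).measurable (measurableSet_singleton 0)
  have hzero'' : ∀ᵐ t ∂(@haarAddCircle (2 * Real.pi) _), Φ y t = 0 := by
    rw [volume_eq_smul_haarAddCircle, Measure.ae_ennreal_smul_measure_iff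
      (ENNReal.ofReal_pos.2 Real.two_pi_pos).ne'] at hzero'
    exact hzero'
  have : Φ y = 0 := by
    rw [Lp.eq_zero_iff_ae_eq_zero]
    exact hzero''
  exact (map_eq_zero_iff _ fourierBasis.repr.symm.injective).1 this

/-- An analytic function in the disk with square summable Taylor coefficients is in `H²`. -/
theorem memH2_of_hasSum {a : ℕ → ℂ} (ha : Summable fun n => ‖a n‖ ^ 2) {g : ℂ → ℂ}
    (hd : DifferentiableOn ℂ g (Metric.ball 0 1))
    (hg : ∀ z ∈ Metric.ball (0 : ℂ) 1, HasSum (fun n => z ^ n * a n) (g z)) : MemH2 g := by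
  refine ⟨hd, max (‖g 0‖ ^ 2) (∑' n, ‖a n‖ ^ 2), fun r h0 h1 => ?_⟩
  rcases h0.eq_or_lt with rfl | h0
  · rw [Real.circleAverage_zero]
    exact le_max_left _ _
  refine le_max_of_le_right ?_
  -- On the circle of radius `r`, `g` is the `r`-th Abel mean of the Fourier series with the
  -- coefficients `a`, extended by `0` to the negative integers.
  set b : ℤ → ℂ := fun k => if 0 ≤ k then a k.toNat else 0 with hb
  have hinj : Function.Injective (Nat.cast : ℕ → ℤ) := Nat.cast_injective
  have hsupp : ∀ k ∉ range (Nat.cast : ℕ → ℤ), b k = 0 := fun k hk => by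
    refine if_neg fun hk' => hk ⟨k.toNat, Int.toNat_of_nonneg hk'⟩
  have hbn : ∀ n : ℕ, b n = a n := fun n => by simp [hb]
  have hbs : HasSum (fun k => ‖b k‖ ^ 2) (∑' n, ‖a n‖ ^ 2) := by
    refine (hinj.hasSum_iff fun k hk => by rw [hsupp k hk]; simp).1 ?_
    simpa [Function.comp_def, hbn] using ha.hasSum
  have hbm : Memℓp b 2 := (memℓp_gen_iff (by norm_num)).2 (by simpa using hbs.summable)
  set y : L2Z := ⟨b, hbm⟩
  have hyb : ∀ k, y k = b k := fun k => rfl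
  have hval : ∀ θ : ℝ, g (circleMap 0 r θ) =
      ∑' k : ℤ, abelCoeff ⟨r, h0, h1⟩ y k * (Circle.exp θ : ℂ) ^ k := fun θ => by
    have hz : circleMap 0 r θ ∈ Metric.ball (0 : ℂ) 1 := by
      rw [mem_ball_zero_iff, norm_circleMap_zero, abs_of_pos h0]
      exact h1
    refine (((hinj.hasSum_iff fun k hk => ?_).1 ?_).tsum_eq).symm
    · rw [abelCoeff_apply, hyb, hsupp k hk]
      simp
    · refine (hg _ hz).congr_fun fun n => ?_
      simp only [Function.comp_apply, abelCoeff_apply, hyb, hbn, circleMap_zero, Circle.coe_exp,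
        Int.natAbs_natCast, zpow_natCast, mul_pow]
      ring
  rw [Real.circleAverage_def]
  simp only [hval, smul_eq_mul]
  rw [integral_norm_sq_exp_series (summable_norm_abelCoeff _ y), ← hbs.tsum_eq]
  refine Summable.tsum_le_tsum (fun k => ?_) (summable_norm_sq _) hbs.summable
  rw [abelCoeff_apply, hyb, norm_mul, norm_pow, Complex.norm_real, Real.norm_of_nonneg h0.le]
  gcongr
  exact mul_le_of_le_one_left (norm_nonneg _) (pow_le_one₀ h0.le h1.le)

end Fourier

/-! ### Resolvents along orbits -/

section Abstract

variable {H : Type*} [NormedAddCommGroup H] [InnerProductSpace ℂ H] [CompleteSpace H]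

/-- A telescoping form of the Neumann series: when `A fₙ = gₙ - z gₙ₊₁` for all `n`, applying `A` to
`∑ zⁿ fₙ` leaves only `g₀`. It covers the expansions of `(1 - z U)⁻¹` and of `(U - z)⁻¹` inside
and outside the disk. -/
theorem hasSum_inverse_apply {A : H →L[ℂ] H} (hA : IsUnit A) {z : ℂ} (hz : ‖z‖ < 1)
    {f g : ℕ → H} {C D : ℝ} (hf : ∀ n, ‖f n‖ ≤ C) (hg : ∀ n, ‖g n‖ ≤ D)
    (h : ∀ n, A (f n) = g n - z • g (n + 1)) :
    HasSum (fun n => z ^ n • f n) (Ring.inverse A (g 0)) := by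
  have summ : ∀ {e : ℕ → H} {B : ℝ}, (∀ n, ‖e n‖ ≤ B) → Summable fun n => z ^ n • e n :=
    fun {e B} he => by
      refine Summable.of_norm_bounded ((summable_geometric_of_lt_one (norm_nonneg z) hz).mul_right B)
        fun n => ?_
      rw [norm_smul, norm_pow]
      exact mul_le_mul_of_nonneg_left (he n) (by positivity)
  have h1 := (summ hf).hasSum
  have h2 := (summ hg).hasSum
  have h3 := h2.sub ((hasSum_nat_add_iff' 1).2 h2)
  rw [Finset.sum_range_one, sub_sub_cancel, pow_zero, one_smul] at h3
  have h4 : A (∑' n, z ^ n • f n) = g 0 := by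
    refine (h1.mapL A).unique (h3.congr_fun fun n => ?_)
    rw [map_smul, h, smul_sub, smul_smul, pow_succ]
  rw [inverse_apply_eq hA h4]
  exact h1

theorem differentiableOn_inverse_apply {B : ℂ → H →L[ℂ] H} {D : Set ℂ}
    (hB : Differentiable ℂ B) (hu : ∀ z ∈ D, IsUnit (B z)) (u : H) :
    DifferentiableOn ℂ (fun z => Ring.inverse (B z) u) D := by
  intro z hz
  exact (((differentiableAt_inverse (𝕜 := ℂ) (hu z hz)).comp z (hB z)).clm_apply
    (differentiableAt_const u)).differentiableWithinAt

/-- `⟨(A* - w)⁻¹ u, v⟩ = ⟨u, (A - w̄)⁻¹ v⟩`. -/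
theorem inner_resolventVec_adjoint {A : H →L[ℂ] H} {w : ℂ}
    (hA : IsUnit (A - (starRingEnd ℂ w) • (1 : H →L[ℂ] H))) (u v : H) :
    inner ℂ v (resolventVec A.adjoint w u) =
      inner ℂ (Ring.inverse (A - (starRingEnd ℂ w) • (1 : H →L[ℂ] H)) v) u := by
  have h1 : star (A - (starRingEnd ℂ w) • (1 : H →L[ℂ] H)) =
      A.adjoint - w • (1 : H →L[ℂ] H) := by
    rw [star_sub, star_smul, star_one, ContinuousLinearMap.star_eq_adjoint]
    simp
  have h2 := hA.star
  rw [h1] at h2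
  conv_lhs => rw [← apply_inverse_apply hA v]
  rw [← ContinuousLinearMap.adjoint_inner_right, ← ContinuousLinearMap.star_eq_adjoint, h1,
    resolventVec, apply_inverse_apply h2]

end Abstract

/-! ### The weak absolutely continuous subspace -/

/-- The vector `e_m ⊕ 0`. -/
noncomputable def fstVec (m : ℤ) : L2Z2 := WithLp.toLp 2 (basisVec m, 0)

theorem norm_basisVec (m : ℤ) : ‖basisVec m‖ = 1 := by
  rw [lp.norm_single (by norm_num), norm_one]

theorem norm_fstVec (m : ℤ) : ‖fstVec m‖ = 1 := by
  rw [fstVec, WithLp.norm_toLp_fst, norm_basisVec]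

theorem inner_fstVec (v : L2Z2) (m : ℤ) : inner ℂ (fstVec m) v = v.fst m := by
  rw [WithLp.prod_inner_apply]
  change inner ℂ (basisVec m) v.fst + inner ℂ (0 : L2Z) v.snd = _
  rw [inner_zero_left, add_zero, lp.inner_single_left]
  simp

theorem norm_inner_fstVec (v : L2Z2) (m : ℤ) : ‖(inner ℂ v (fstVec m) : ℂ)‖ = ‖v.fst m‖ := by
  rw [norm_inner_symm, inner_fstVec]

section

variable {ρ : ℕ → ℝ} (hρ : Tendsto ρ atTop (𝓝 0))

theorem dualOp_fstVec (m : ℤ) : dualOp ρ hρ (fstVec m) = fstVec (m + 1) :=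
  L2Z2_ext (by simp [fstVec, ← shift_basisVec]) (by simp [fstVec])

/-- The Taylor coefficients of `⟨(T - z)⁻¹ (e_m ⊕ 0), v⟩` are coordinates of `v`, each taken once,
and so they are square summable. -/
theorem fstVec_mem_weakPlus (m : ℤ) : fstVec m ∈ weakPlus (dualOp ρ hρ) := by
  have hu : ∀ z ∈ Metric.ball (0 : ℂ) 1, IsUnit (dualOp ρ hρ - z • (1 : L2Z2 →L[ℂ] L2Z2)) :=
    fun z hz => isUnit_dualOp_sub ρ hρ (mem_ball_zero_iff.1 hz).ne
  have hd : DifferentiableOn ℂ (fun z => resolventVec (dualOp ρ hρ) z (fstVec m))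
      (Metric.ball 0 1) :=
    differentiableOn_inverse_apply (by fun_prop) hu _
  refine ⟨⟨_, hd, fun z _ _ => rfl⟩, fun v => ⟨_, memH2_of_hasSum
    (a := fun n : ℕ => inner ℂ v (fstVec (m - n - 1))) ?_
      ((innerSL ℂ v).differentiable.comp_differentiableOn hd) fun z hz => ?_, fun z _ _ => rfl⟩⟩
  · simp only [norm_inner_fstVec]
    exact (summable_norm_sq v.fst).comp_injective (i := fun n : ℕ => m - n - 1)
      fun a b h => by simpa using h
  · have := hasSum_inverse_apply (hu z hz) (mem_ball_zero_iff.1 hz)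
      (f := fun n : ℕ => fstVec (m - n - 1)) (g := fun n : ℕ => fstVec (m - n))
      (fun n => (norm_fstVec _).le) (fun n => (norm_fstVec _).le) fun n => by
        rw [sub_apply, dualOp_fstVec, smul_apply, one_apply_eq_self, sub_add_cancel]
        push_cast
        rw [sub_add_eq_sub_sub]
    rw [Nat.cast_zero, sub_zero] at this
    simpa [resolventVec] using this.mapL (innerSL ℂ v)

theorem fstVec_mem_weakMinus (m : ℤ) : fstVec m ∈ weakMinus (dualOp ρ hρ) := by
  have hu : ∀ z ∈ Metric.ball (0 : ℂ) 1, IsUnit (1 - z • dualOp ρ hρ) :=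
    fun z hz => isUnit_one_sub_smul_dualOp ρ hρ (mem_ball_zero_iff.1 hz)
  have hu' : ∀ z ∈ (Metric.closedBall (0 : ℂ) 1)ᶜ,
      IsUnit (dualOp ρ hρ - z • (1 : L2Z2 →L[ℂ] L2Z2)) := fun z hz =>
    isUnit_dualOp_sub ρ hρ fun h => hz (mem_closedBall_zero_iff.2 h.le)
  have hd : DifferentiableOn ℂ (fun z => coresolventVec (dualOp ρ hρ) z (fstVec m))
      (Metric.ball 0 1) :=
    differentiableOn_inverse_apply (by fun_prop) hu _
  refine ⟨⟨_, differentiableOn_inverse_apply (by fun_prop) hu' _, fun z _ _ => rfl⟩,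
    fun v => ⟨_, memH2_of_hasSum (a := fun n : ℕ => inner ℂ v (fstVec (m + n))) ?_
      ((innerSL ℂ v).differentiable.comp_differentiableOn hd) fun z hz => ?_, fun z _ _ => rfl⟩⟩
  · simp only [norm_inner_fstVec]
    exact (summable_norm_sq v.fst).comp_injective (i := fun n : ℕ => m + n)
      fun a b h => by simpa using h
  · have := hasSum_inverse_apply (hu z hz) (mem_ball_zero_iff.1 hz)
      (f := fun n : ℕ => fstVec (m + n)) (g := fun n : ℕ => fstVec (m + n))
      (fun n => (norm_fstVec _).le) (fun n => (norm_fstVec _).le) fun n => by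
        rw [sub_apply, smul_apply, dualOp_fstVec, one_apply_eq_self]
        push_cast
        rw [add_assoc]
    rw [Nat.cast_zero, add_zero] at this
    simpa [coresolventVec] using this.mapL (innerSL ℂ v)

/-- The vectors `e_m ⊕ 0` span a dense subspace of `ℓ²(ℤ) ⊕ 0`. -/
theorem firstSummand_le_of_isClosed {M : Submodule ℂ L2Z2} (hM : IsClosed (M : Set L2Z2))
    (h : ∀ m, fstVec m ∈ M) : firstSummand ≤ M := by
  intro x hx
  rw [mem_firstSummand] at hx
  have h1 := (lp.hasSum_single (p := 2) (by norm_num) x.fst).mapL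
    (((WithLp.prodContinuousLinearEquiv 2 ℂ L2Z L2Z).symm : L2Z × L2Z →L[ℂ] L2Z2) ∘L
      ContinuousLinearMap.inl ℂ L2Z L2Z)
  have h2 : (((WithLp.prodContinuousLinearEquiv 2 ℂ L2Z L2Z).symm : L2Z × L2Z →L[ℂ] L2Z2) ∘L
      ContinuousLinearMap.inl ℂ L2Z L2Z) x.fst = x := L2Z2_ext rfl hx.symm
  rw [h2] at h1
  refine hM.mem_of_tendsto h1 (Eventually.of_forall fun s => M.sum_mem fun m _ => ?_)
  have h3 : (((WithLp.prodContinuousLinearEquiv 2 ℂ L2Z L2Z).symm : L2Z × L2Z →L[ℂ] L2Z2) ∘L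
      ContinuousLinearMap.inl ℂ L2Z L2Z) (lp.single 2 m (x.fst m)) = x.fst m • fstVec m := by
    refine L2Z2_ext ?_ (by simp [fstVec])
    rw [WithLp.smul_fst]
    change lp.single 2 m (x.fst m) = x.fst m • basisVec m
    rw [← lp.single_smul, smul_eq_mul, mul_one]
  rw [h3]
  exact M.smul_mem _ (h m)

theorem firstSummand_le_weakAC : firstSummand ≤ weakAC (dualOp ρ hρ) :=
  firstSummand_le_of_isClosed (Submodule.isClosed_topologicalClosure _) fun m =>
    Submodule.le_topologicalClosure _ ⟨fstVec_mem_weakPlus hρ m, fstVec_mem_weakMinus hρ m⟩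

theorem weakAC_le_CN {H : Type*} [NormedAddCommGroup H] [InnerProductSpace ℂ H] (A : H →L[ℂ] H) :
    weakAC A ≤ CN A :=
  Submodule.topologicalClosure_mono (inf_le_left.trans le_sup_left)

theorem CN_dualOp (hpos : ∀ n, 0 < ρ n) (hmono : Antitone ρ) (hsum : ¬ Summable ρ) :
    CN (dualOp ρ hρ) = firstSummand :=
  (CN_le_firstSummand hρ hpos hmono hsum).antisymm
    ((firstSummand_le_weakAC hρ).trans (weakAC_le_CN _))

theorem weakAC_dualOp (hpos : ∀ n, 0 < ρ n) (hmono : Antitone ρ) (hsum : ¬ Summable ρ) :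
    weakAC (dualOp ρ hρ) = firstSummand :=
  ((weakAC_le_CN _).trans (CN_le_firstSummand hρ hpos hmono hsum)).antisymm
    (firstSummand_le_weakAC hρ)

theorem firstSummand_ne_top : firstSummand ≠ ⊤ := by
  intro h
  have h1 : (WithLp.toLp 2 (0, basisVec 0) : L2Z2) ∈ firstSummand := h ▸ Submodule.mem_top
  have h2 : basisVec 0 = 0 := h1
  have := norm_basisVec 0
  rw [h2, norm_zero] at this
  exact zero_ne_one this

theorem firstSummand_orthogonal_ne_bot : firstSummandᗮ ≠ ⊥ := by
  have : CompleteSpace firstSummand := isClosed_firstSummand.completeSpace_coe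
  intro h
  exact firstSummand_ne_top (Submodule.orthogonal_eq_bot_iff.1 h)

end

/-! ### The singular subspace of the adjoint -/

/-- The scalar function `⟨(U* - w)⁻¹ x, e₀⟩` inside the disk, with `(U* - w)⁻¹` moved to the
other side of the inner product. -/
theorem hasSum_inner_shift_inverse_of_lt {w : ℂ} (hw : ‖w‖ < 1) (x : L2Z) :
    HasSum (fun n : ℕ => w ^ n * x (-n - 1))
      (inner ℂ (Ring.inverse (shift - (starRingEnd ℂ w) • (1 : L2Z →L[ℂ] L2Z)) (basisVec 0)) x) := by
  have hw' : ‖starRingEnd ℂ w‖ < 1 := by rwa [RCLike.norm_conj]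
  have h := hasSum_inverse_apply (isUnit_shift_sub hw'.ne) hw'
    (f := fun n : ℕ => basisVec (-n - 1)) (g := fun n : ℕ => basisVec (-n))
    (fun n => (norm_basisVec _).le) (fun n => (norm_basisVec _).le) fun n => by
      rw [sub_apply, smul_apply, one_apply_eq_self, shift_basisVec, sub_add_cancel]
      push_cast
      rw [neg_add']
  rw [Nat.cast_zero, neg_zero] at h
  simpa [inner_smul_left, lp.inner_single_left] using h.mapL ((innerSL ℂ).flip x)

/-- The scalar function `⟨(U* - w)⁻¹ x, e₀⟩` outside the disk. -/
theorem hasSum_inner_shift_inverse_of_gt {w : ℂ} (hw : 1 < ‖w‖) (x : L2Z) :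
    HasSum (fun n : ℕ => -(w⁻¹ ^ (n + 1) * x n))
      (inner ℂ (Ring.inverse (shift - (starRingEnd ℂ w) • (1 : L2Z →L[ℂ] L2Z)) (basisVec 0)) x) := by
  have hw' : 1 < ‖starRingEnd ℂ w‖ := by rwa [RCLike.norm_conj]
  have h0 : starRingEnd ℂ w ≠ 0 := norm_pos_iff.1 (one_pos.trans hw')
  have hz : ‖(starRingEnd ℂ w)⁻¹‖ < 1 := by
    rw [norm_inv]
    exact inv_lt_one_of_one_lt₀ hw'
  have h := hasSum_inverse_apply (isUnit_shift_sub hw'.ne') hz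
    (f := fun n : ℕ => -((starRingEnd ℂ w)⁻¹ • basisVec n)) (g := fun n : ℕ => basisVec n)
    (C := 1) (fun n => by rw [norm_neg, norm_smul, norm_basisVec, mul_one]; exact hz.le)
    (fun n => (norm_basisVec _).le) fun n => by
      rw [sub_apply, smul_apply, one_apply_eq_self, map_neg, map_smul, shift_basisVec, smul_neg,
        smul_smul, mul_inv_cancel₀ h0, one_smul]
      push_cast
      abel
  rw [Nat.cast_zero] at h
  refine (h.mapL ((innerSL ℂ).flip x)).congr_fun fun n => ?_
  simp [lp.inner_single_left, pow_succ, mul_assoc]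

theorem inside_mem_stolz {ζ : ℂ} (hζ : ‖ζ‖ = 1) {r : ℝ} (h0 : 0 < r) (h1 : r < 1) :
    (r : ℂ) * ζ ∈ stolzInside 2 ζ := by
  have e1 : ‖(r : ℂ) * ζ‖ = r := by
    rw [norm_mul, hζ, mul_one, Complex.norm_real, Real.norm_of_nonneg h0.le]
  have e2 : ‖(r : ℂ) * ζ - ζ‖ = 1 - r := by
    rw [← sub_one_mul, norm_mul, hζ, mul_one, norm_sub_rev, ← Complex.ofReal_one,
      ← Complex.ofReal_sub, Complex.norm_real, Real.norm_of_nonneg (by linarith)]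
  refine ⟨e1.trans_lt h1, ?_⟩
  rw [e1, e2]
  linarith

theorem outside_mem_stolz {ζ : ℂ} (hζ : ‖ζ‖ = 1) {r : ℝ} (h1 : 1 < r) :
    (r : ℂ) * ζ ∈ stolzOutside 2 ζ := by
  have e1 : ‖(r : ℂ) * ζ‖ = r := by
    rw [norm_mul, hζ, mul_one, Complex.norm_real, Real.norm_of_nonneg (by linarith)]
  have e2 : ‖(r : ℂ) * ζ - ζ‖ = r - 1 := by
    rw [← sub_one_mul, norm_mul, hζ, mul_one, ← Complex.ofReal_one,
      ← Complex.ofReal_sub, Complex.norm_real, Real.norm_of_nonneg (by linarith)]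
  refine ⟨h1.trans_eq e1.symm, ?_⟩
  rw [e1, e2]
  linarith

/-- A vector is `0` if the scalar resolvent function of the shift that it defines has no jump
across the circle: the difference of the values at `r ζ` and at `ζ / r` is the `r`-th Abel mean of
the Fourier series with coefficients `x₋ₖ₋₁`. -/
theorem eq_zero_of_no_jump {x : L2Z} {F : ℂ → ℂ}
    (hF : ∀ w : ℂ, ‖w‖ ≠ 1 → F w =
      inner ℂ (Ring.inverse (shift - (starRingEnd ℂ w) • (1 : L2Z →L[ℂ] L2Z)) (basisVec 0)) x)
    (h : ∀ᵐ θ : ℝ, ∃ a : ℂ, HasCommonNontangentialLimit F (Circle.exp θ) a) : x = 0 := by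
  have hinj : Function.Injective fun k : ℤ => -k - 1 := fun a b h => by simpa using h
  have hy : Memℓp (fun k : ℤ => x (-k - 1)) 2 := by
    have h := lp.memℓp x
    rw [memℓp_gen_iff (by norm_num)] at h ⊢
    exact h.comp_injective hinj
  set y : L2Z := ⟨_, hy⟩
  have hyx : ∀ k, y k = x (-k - 1) := fun k => rfl
  suffices hy0 : y = 0 by
    ext k
    have := hyx (-k - 1)
    rw [hy0, show -(-k - 1) - 1 = k by ring] at this
    exact this.symm
  refine eq_zero_of_abelMeans_tendsto_zero ?_
  filter_upwards [h] with θ hθ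
  obtain ⟨a, ha⟩ := hθ
  obtain ⟨hin, hout⟩ := ha 2 one_lt_two
  set ζ := ((Circle.exp θ : Circle) : ℂ)
  have hζ : ‖ζ‖ = 1 := Circle.norm_coe _
  have hζ0 : ζ ≠ 0 := norm_pos_iff.1 (hζ ▸ one_pos)
  have hr : Tendsto (fun r : Ioo (0 : ℝ) 1 => (r : ℝ)) (comap Subtype.val (𝓝 1)) (𝓝 1) :=
    tendsto_comap
  have hr' : Tendsto (fun r : Ioo (0 : ℝ) 1 => (r : ℝ)⁻¹) (comap Subtype.val (𝓝 1)) (𝓝 1) := by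
    simpa using hr.inv₀ one_ne_zero
  have lim : ∀ {s : Ioo (0 : ℝ) 1 → ℝ}, Tendsto s (comap Subtype.val (𝓝 1)) (𝓝 1) →
      Tendsto (fun r => (s r : ℂ) * ζ) (comap Subtype.val (𝓝 1)) (𝓝 ζ) := fun {s} hs => by
    simpa using ((Complex.continuous_ofReal.tendsto 1).comp hs).mul_const ζ
  have t1 : Tendsto (fun r : Ioo (0 : ℝ) 1 => ((r : ℝ) : ℂ) * ζ) (comap Subtype.val (𝓝 1))
      (𝓝[stolzInside 2 ζ] ζ) :=
    tendsto_nhdsWithin_iff.2 ⟨lim hr, Eventually.of_forall fun r =>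
      inside_mem_stolz hζ r.2.1 r.2.2⟩
  have t2 : Tendsto (fun r : Ioo (0 : ℝ) 1 => (((r : ℝ)⁻¹ : ℝ) : ℂ) * ζ)
      (comap Subtype.val (𝓝 1)) (𝓝[stolzOutside 2 ζ] ζ) :=
    tendsto_nhdsWithin_iff.2 ⟨lim hr', Eventually.of_forall fun r =>
      outside_mem_stolz hζ ((one_lt_inv₀ r.2.1).2 r.2.2)⟩
  have t3 := (hin.comp t1).sub (hout.comp t2)
  rw [sub_self] at t3
  refine t3.congr fun r => ?_
  have m1 := (inside_mem_stolz hζ r.2.1 r.2.2).1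
  have m2 := (outside_mem_stolz hζ ((one_lt_inv₀ r.2.1).2 r.2.2)).1
  have s1 := hasSum_inner_shift_inverse_of_lt m1 x
  have s2 := (hasSum_inner_shift_inverse_of_gt m2 x).neg
  rw [← hF _ m1.ne] at s1
  rw [← hF _ m2.ne'] at s2
  rw [Function.comp_apply, Function.comp_apply, sub_eq_add_neg]
  refine (HasSum.tsum_eq (HasSum.of_nat_of_neg_add_one
    (s1.congr_fun fun n => ?_) (s2.congr_fun fun n => ?_))).symm
  · rw [abelCoeff_apply, hyx, Int.natAbs_natCast, zpow_natCast, mul_pow]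
    ring
  · have e1 : (-((n : ℤ) + 1)).natAbs = n + 1 := by omega
    have e2 : -(-((n : ℤ) + 1)) - 1 = n := by ring
    have e3 : ζ ^ (-((n : ℤ) + 1)) = (ζ ^ (n + 1))⁻¹ := by
      rw [zpow_neg]
      norm_cast
    rw [abelCoeff_apply, hyx, e1, e2, e3, neg_neg, mul_inv, mul_pow, Complex.ofReal_inv, inv_inv,
      inv_pow]
    ring

/-- Testing against `e₀ ⊕ 0` only sees the shift and gives `u.fst = 0`; after that, testing
against `0 ⊕ e₀` only sees the shift as well. -/
theorem singularSubspace_adjoint_dualOp {ρ : ℕ → ℝ} (hρ : Tendsto ρ atTop (𝓝 0)) :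
    singularSubspace (dualOp ρ hρ).adjoint = ⊥ := by
  suffices h : singularVectors (dualOp ρ hρ).adjoint = ⊥ by
    rw [singularSubspace, h]
    exact (isClosed_singleton (x := (0 : L2Z2))).submodule_topologicalClosure_eq
  rw [eq_bot_iff]
  intro u hu
  have hA : ∀ w : ℂ, ‖w‖ ≠ 1 →
      IsUnit (dualOp ρ hρ - (starRingEnd ℂ w) • (1 : L2Z2 →L[ℂ] L2Z2)) := fun w hw =>
    isUnit_dualOp_sub ρ hρ (by rwa [RCLike.norm_conj])
  have hB : ∀ w : ℂ, ‖w‖ ≠ 1 →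
      IsUnit (shift - (starRingEnd ℂ w) • (1 : L2Z →L[ℂ] L2Z)) := fun w hw =>
    isUnit_shift_sub (by rwa [RCLike.norm_conj])
  have h1 : u.fst = 0 := by
    refine eq_zero_of_no_jump (fun w hw => ?_) (hu (fstVec 0))
    rw [inner_resolventVec_adjoint (hA w hw)]
    set q := Ring.inverse (shift - (starRingEnd ℂ w) • (1 : L2Z →L[ℂ] L2Z)) (basisVec 0)
    have h3 : Ring.inverse (dualOp ρ hρ - (starRingEnd ℂ w) • (1 : L2Z2 →L[ℂ] L2Z2)) (fstVec 0) =
        WithLp.toLp 2 (q, 0) :=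
      inverse_apply_eq (hA w hw) (L2Z2_ext
        (by simpa [fstVec] using apply_inverse_apply (hB w hw) (basisVec 0)) (by simp [fstVec]))
    rw [h3, WithLp.prod_inner_apply]
    simp
  have h2 : u.snd = 0 := by
    refine eq_zero_of_no_jump (fun w hw => ?_) (hu (WithLp.toLp 2 (0, basisVec 0)))
    rw [inner_resolventVec_adjoint (hA w hw), WithLp.prod_inner_apply]
    set q := Ring.inverse (dualOp ρ hρ - (starRingEnd ℂ w) • (1 : L2Z2 →L[ℂ] L2Z2))
      (WithLp.toLp 2 (0, basisVec 0))
    have h3 : Ring.inverse (shift - (starRingEnd ℂ w) • (1 : L2Z →L[ℂ] L2Z)) (basisVec 0) =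
        q.snd := by
      refine inverse_apply_eq (hB w hw) ?_
      simpa using congrArg (fun p : L2Z2 => p.snd)
        (apply_inverse_apply (hA w hw) (WithLp.toLp 2 (0, basisVec 0)))
    rw [h3]
    change inner ℂ q.fst u.fst + inner ℂ q.snd u.snd = _
    rw [h1, inner_zero_right, zero_add]
  exact (Submodule.mem_bot ℂ).2 (L2Z2_ext h1 h2)

/-! ### The compact part -/

section

variable {ρ : ℕ → ℝ} (hρ : Tendsto ρ atTop (𝓝 0))

theorem norm_diagOp_le {c : ℝ} (h : ∀ n, |ρ n| ≤ c) : ‖diagOp ρ hρ‖ ≤ c :=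
  (lp.norm_mapCLM_le _ _ _ _).trans (ciSup_le h)

theorem isCompactOperator_coord_smul (m : ℤ) (y : L2Z) :
    IsCompactOperator fun x : L2Z => x m • y := by
  have h : IsCompactOperator (id : ℂ → ℂ) := isCompactOperator_id
  have h1 := (h.comp_clm (innerSL ℂ (basisVec m))).clm_comp
    (ContinuousLinearMap.toSpanSingleton ℂ y)
  refine Eq.mp (congrArg IsCompactOperator (funext fun x => ?_)) h1
  simp [lp.inner_single_left]

/-- A truncated sequence tends to `0`, so that `diagOp` applies to it. -/
theorem tendsto_truncate (ρ : ℕ → ℝ) (N : ℕ) :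
    Tendsto (fun n => if n < N then ρ n else 0) atTop (𝓝 0) :=
  tendsto_const_nhds.congr' ((eventually_ge_atTop N).mono fun _ hn => (if_neg hn.not_gt).symm)

theorem isCompactOperator_diagOp_truncate (ρ : ℕ → ℝ) (N : ℕ) :
    IsCompactOperator (diagOp _ (tendsto_truncate ρ N)) := by
  have h : ∀ s : Finset ℤ, IsCompactOperator fun x : L2Z =>
      ∑ m ∈ s, x m • ((ρ m.natAbs : ℂ) • basisVec m) := fun s => by
    classical
    induction s using Finset.induction_on with
    | empty => exact isCompactOperator_zero
    | insert a s ha ih =>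
      simp only [Finset.sum_insert ha]
      exact (isCompactOperator_coord_smul a _).add ih
  convert h (Finset.Ioo (-N : ℤ) N) using 1
  ext x n
  rw [diagOp_apply, lp.coeFn_sum, Finset.sum_apply]
  simp only [lp.coeFn_smul, Pi.smul_apply, smul_eq_mul]
  by_cases hn : n.natAbs < N
  · rw [Finset.sum_eq_single n]
    · rw [if_pos hn, lp.single_apply_self]
      ring
    · intro b _ hb
      rw [lp.single_apply_ne _ _ _ hb.symm, mul_zero, mul_zero]
    · intro h
      exact absurd (Finset.mem_Ioo.2 (by omega)) h
  · rw [Finset.sum_eq_zero]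
    · simp [hn]
    · intro b hb
      have : n ≠ b := by
        rintro rfl
        rw [Finset.mem_Ioo] at hb
        omega
      rw [lp.single_apply_ne _ _ _ this, mul_zero, mul_zero]

theorem isCompactOperator_diagOp (hpos : ∀ n, 0 < ρ n) (hmono : Antitone ρ) :
    IsCompactOperator (diagOp ρ hρ) := by
  refine isCompactOperator_of_tendsto (l := atTop)
    (F := fun N : ℕ => diagOp _ (tendsto_truncate ρ N)) ?_
    (Eventually.of_forall fun N => isCompactOperator_diagOp_truncate ρ N)
  rw [tendsto_iff_norm_sub_tendsto_zero]
  refine squeeze_zero (fun _ => norm_nonneg _) (fun N => ?_) hρ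
  have h1 : diagOp _ (tendsto_truncate ρ N) - diagOp ρ hρ =
      diagOp (fun n => (if n < N then ρ n else 0) - ρ n)
        (by simpa using (tendsto_truncate ρ N).sub hρ) := by
    ext x n
    rw [sub_apply, lp.coeFn_sub, Pi.sub_apply, diagOp_apply, diagOp_apply, diagOp_apply]
    push_cast
    ring
  rw [h1]
  refine norm_diagOp_le _ fun n => ?_
  split_ifs with h
  · rw [sub_self, abs_zero]
    exact (hpos N).le
  · rw [zero_sub, abs_neg, abs_of_pos (hpos n)]
    exact hmono (not_lt.1 h)

theorem isCompactOperator_blockOp_diagOp (hpos : ∀ n, 0 < ρ n) (hmono : Antitone ρ) :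
    IsCompactOperator (blockOp 0 (diagOp ρ hρ) 0 0) := by
  have h := ((isCompactOperator_diagOp hρ hpos hmono).comp_clm (WithLp.sndL 2 ℂ L2Z L2Z)).clm_comp
    (((WithLp.prodContinuousLinearEquiv 2 ℂ L2Z L2Z).symm : L2Z × L2Z →L[ℂ] L2Z2) ∘L
      ContinuousLinearMap.inl ℂ L2Z L2Z)
  refine Eq.mp (congrArg IsCompactOperator (funext fun x => ?_)) h
  exact L2Z2_ext (by simp) (by simp)

theorem dualOp_eq_add : dualOp ρ hρ = blockOp shift 0 0 shift + blockOp 0 (diagOp ρ hρ) 0 0 :=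
  ContinuousLinearMap.ext fun x => L2Z2_ext (by simp) (by simp)

/-- The space of the vectors `0 ⊕ y` for which `y` is supported on `|m| < k`. -/
noncomputable def sndSupported (k : ℕ) : Submodule ℂ L2Z2 where
  carrier := {x | x.fst = 0 ∧ ∀ m : ℤ, k ≤ m.natAbs → x.snd m = 0}
  zero_mem' := ⟨rfl, fun _ _ => rfl⟩
  add_mem' := by
    rintro a b ⟨ha, ha'⟩ ⟨hb, hb'⟩
    exact ⟨by simp [ha, hb], fun m hm => by simp [ha' m hm, hb' m hm]⟩
  smul_mem' := by
    rintro c a ⟨ha, ha'⟩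
    exact ⟨by simp [ha], fun m hm => by simp [ha' m hm]⟩

/-- There are `2 k - 1` integers with `|m| < k` if `k > 0`, and none if `k = 0`; the truncated
subtraction in the bound covers both cases. -/
theorem rank_sndSupported_le (k : ℕ) :
    Module.rank ℂ (sndSupported k) ≤ ((2 * k - 1 : ℕ) : Cardinal) := by
  let f : sndSupported k →ₗ[ℂ] (Finset.Ioo (-k : ℤ) k → ℂ) :=
    { toFun := fun x m => (x : L2Z2).snd m
      map_add' := fun _ _ => rfl
      map_smul' := fun _ _ => rfl }
  have hf : Function.Injective f := by
    refine (injective_iff_map_eq_zero f).2 fun x hx => Subtype.ext (L2Z2_ext x.2.1 ?_)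
    ext m
    by_cases hm : k ≤ m.natAbs
    · exact x.2.2 m hm
    · exact congrFun hx ⟨m, Finset.mem_Ioo.2 (by omega)⟩
  refine (LinearMap.rank_le_of_injective f hf).trans_eq ?_
  rw [rank_fun', Fintype.card_coe, Int.card_Ioo]
  congr 1
  omega

/-- An eigenvector of `S* S` with eigenvalue `s² > ρₖ²`, for `S (x ⊕ y) = R y ⊕ 0`, lives on the
coordinates of the second component where `ρ_|m| = s > ρₖ`; by monotonicity these have `|m| < k`. -/
theorem eigenspace_le_sndSupported (hpos : ∀ n, 0 < ρ n) (hmono : Antitone ρ) {k : ℕ} {s : ℝ}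
    (hs : ρ k < s) :
    Module.End.eigenspace (((blockOp 0 (diagOp ρ hρ) 0 0).adjoint ∘L blockOp 0 (diagOp ρ hρ) 0 0 :
      L2Z2 →L[ℂ] L2Z2) : Module.End ℂ L2Z2) ((s : ℂ) ^ 2) ≤ sndSupported k := by
  intro x hx
  rw [Module.End.mem_eigenspace_iff] at hx
  set S := blockOp 0 (diagOp ρ hρ) 0 0 with hS
  have hs0 : 0 < s := (hpos k).trans hs
  have hs0' : (s : ℂ) ^ 2 ≠ 0 := pow_ne_zero 2 (Complex.ofReal_ne_zero.2 hs0.ne')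
  have key : ∀ y, inner ℂ (S y) (S x) = (s : ℂ) ^ 2 * inner ℂ y x := fun y => by
    rw [← ContinuousLinearMap.adjoint_inner_right, ← inner_smul_right, ← hx]
    rfl
  constructor
  · ext m
    have h1 := key (fstVec m)
    have h2 : S (fstVec m) = 0 := L2Z2_ext (by simp [hS, fstVec]) (by simp [hS])
    rw [h2, inner_zero_left, inner_fstVec] at h1
    exact (mul_eq_zero.1 h1.symm).resolve_left hs0'
  · intro m hm
    have h1 := key (WithLp.toLp 2 (0, basisVec m))
    have h2 : S (WithLp.toLp 2 (0, basisVec m)) = (ρ m.natAbs : ℂ) • fstVec m :=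
      L2Z2_ext (by rw [WithLp.smul_fst]; simp [hS, fstVec, diagOp_basisVec])
        (by rw [WithLp.smul_snd]; simp [hS, fstVec])
    have h3 : inner ℂ (WithLp.toLp 2 (0, basisVec m) : L2Z2) x = x.snd m := by
      rw [WithLp.prod_inner_apply]
      change inner ℂ (0 : L2Z) x.fst + inner ℂ (basisVec m) x.snd = _
      rw [inner_zero_left, zero_add, lp.inner_single_left]
      simp
    have h4 : (S x).fst m = ρ m.natAbs * x.snd m := by simp [hS]
    rw [h2, inner_smul_left, inner_fstVec, h3, h4, Complex.conj_ofReal] at h1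
    have h5 : ((ρ m.natAbs ^ 2 - s ^ 2 : ℝ) : ℂ) * x.snd m = 0 := by
      push_cast
      linear_combination h1
    refine (mul_eq_zero.1 h5).resolve_left (Complex.ofReal_ne_zero.2 ?_)
    have h6 : ρ m.natAbs < s := (hmono hm).trans_lt hs
    nlinarith [hpos m.natAbs]

theorem singularNumber_blockOp_le (hpos : ∀ n, 0 < ρ n) (hmono : Antitone ρ) {n : ℕ}
    (hn : 1 ≤ n) : singularNumber (blockOp 0 (diagOp ρ hρ) 0 0) n ≤ ρ (n / 2) := by
  refine Real.sSup_le ?_ (hpos _).le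
  intro t htr
  by_contra! ht
  -- `n` eigenvalues above `ρ (n / 2)` would need `n` dimensions in a space with at most
  -- `2 (n / 2) - 1` of them
  have h1 := htr.2.trans (Submodule.rank_mono (t := sndSupported (n / 2)) (iSup₂_le fun s hs =>
    eigenspace_le_sndSupported hρ hpos hmono (ht.trans_le hs)))
  have h2 : n ≤ 2 * (n / 2) - 1 :=
    Nat.cast_le.1 (h1.trans (rank_sndSupported_le (n / 2)))
  omega

end

end SpectralDuality

theorem theorem5 (ρ : ℕ → ℝ) (hpos : ∀ n, 0 < ρ n) (hmono : Antitone ρ)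
    (hlim : Filter.Tendsto ρ Filter.atTop (nhds 0)) (hsum : ¬ Summable ρ) :
    -- the spectrum of `T` is the unit circle
    spectrum ℂ (SpectralDuality.dualOp ρ hlim) = Metric.sphere (0 : ℂ) 1 ∧
    -- `CN(T)` is the proper subspace `ℓ²(ℤ) ⊕ 0`
    SpectralDuality.CN (SpectralDuality.dualOp ρ hlim) ≠ ⊤ ∧
    SpectralDuality.CN (SpectralDuality.dualOp ρ hlim) = SpectralDuality.firstSummand ∧
    -- `H_s(T*) = {0}`
    SpectralDuality.singularSubspace
      (ContinuousLinearMap.adjoint (SpectralDuality.dualOp ρ hlim)) = ⊥ ∧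
    -- `T` is a unitary operator plus an operator with small singular numbers
    (∃ T₀ S : SpectralDuality.L2Z2 →L[ℂ] SpectralDuality.L2Z2,
      SpectralDuality.dualOp ρ hlim = T₀ + S ∧
      T₀ ∈ unitary (SpectralDuality.L2Z2 →L[ℂ] SpectralDuality.L2Z2) ∧
      IsCompactOperator S ∧
      ∀ n : ℕ, 1 ≤ n → SpectralDuality.singularNumber S n ≤ ρ (n / 2)) ∧
    -- the duality fails for `T`
    (SpectralDuality.weakAC (SpectralDuality.dualOp ρ hlim))ᗮ ≠
      SpectralDuality.singularSubspace
        (ContinuousLinearMap.adjoint (SpectralDuality.dualOp ρ hlim)) := by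
  have hCN := SpectralDuality.CN_dualOp hlim hpos hmono hsum
  have hs := SpectralDuality.singularSubspace_adjoint_dualOp hlim
  refine ⟨SpectralDuality.spectrum_dualOp ρ hlim, ?_, hCN, hs,
    ⟨_, _, SpectralDuality.dualOp_eq_add hlim, SpectralDuality.blockOp_shift_mem_unitary,
      SpectralDuality.isCompactOperator_blockOp_diagOp hlim hpos hmono,
      fun n hn => SpectralDuality.singularNumber_blockOp_le hlim hpos hmono hn⟩, ?_⟩
  · rw [hCN]
    exact SpectralDuality.firstSummand_ne_top
  · rw [hs, SpectralDuality.weakAC_dualOp hlim hpos hmono hsum]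
    exact SpectralDuality.firstSummand_orthogonal_ne_bot
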